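/- Let $E$ be a finite set, let $\mathbf P=(p_{kl})_{k,l\in E}$ be an irreducible stochastic matrix (it may, but need not, have $p_{kk}=0$ for all $k$), and let $\bar\tau_k>0$, $k\in E$. Let $\Gamma=\{\Gamma(u),u\in\mathbb R\}$ be the stationary semi-Markov process with values in $E$, routing matrix $\mathbf P$ and exponential sojourn times $T_k\sim\mathrm{Exp}(\bar\tau_k)$: when a sojourn in state $k$ ends, the process moves to state $l$ with probability $p_{kl}$, and, given the sequence of visited states, the sojourn times are independent (the stationary version is obtained from the Palm version, which has a transition at time $0$, by Palm inversion). Let $\lambda_k\ge 0$ be the arrival rates, $\mu>0$ the rate of the exponential service requests, $\beta_k\ge0$ the server speeds, with $\beta_k>0$ for at least one $k$, and put $\mu_k=\mu\beta_k$. Let $$F_\Gamma(u)=\int_u^0\beta_{\Gamma(t)}\,dt,\qquad A_\Gamma=\{(u,\sigma):u<0,\ \sigma>0,\ \sigma>F_\Gamma(u)\},\qquad |A_\Gamma|_\Gamma=\int_{A_\Gamma}\lambda_{\Gamma(u)}\,du\,\mu e^{-\mu\sigma}\,d\sigma ,$$ and let $\vec m^{\dagger(n)}$ be the row vector of the conditional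 moments $m^{(n)}_k=\mathbb E\big[\,|A_\Gamma|_\Gamma^{\,n}\,\big|\,\Gamma(0)=k\big]$, $k\in E$, $n\ge 0$. (Given $\Gamma$, the number of customers at time $0$ in the stationary M/M/$\infty$ queue with environment $\Gamma$ is Poisson with parameter $|A_\Gamma|_\Gamma$, so $m^{(n)}_k$ is its $n$-th factorial moment given $\Gamma(0)=k$.) Let $\mathbf M=\mathrm{diag}(\mu_k)$, $\mathbf\Lambda=\mathrm{diag}(\lambda_k)$, let $\mathbf G=\mathrm{diag}(\bar\tau_k)(\mathbf P-\mathbf I)$ be the generator of the Markov environment, and let $\mathbf\Pi=\mathrm{diag}(\varpi_k)$, where $\varpi$ is the stationary distribution of the environment, i.e. the probability vector with $\varpi\mathbf G=0$. Then $\Pr\{\Gamma(0)=k\}=\varpi_k>0$ for every $k$, $|A_\Gamma|_\Gamma<\infty$ almost surely, all the moments $m^{(n)}_k$ are finite, and for every integer $n\ge1$ $$(\vec m^{\dagger(n)}\mathbf\Pi)\,(n\mathbf M-\mathbf G)=n\,(\vec m^{\dagger(n-1)}\mathbf\Pi)\,\mathbf\Lambda .$$ -/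

import Mathlib

open MeasureTheory ProbabilityTheory Matrix
open scoped ENNReal

namespace SemiMarkovQueue

noncomputable section

/-- `π` is a stationary distribution of the stochastic matrix `P`. -/
def IsStationaryDistribution {E : Type*} [Fintype E] (P : Matrix E E ℝ) (π : E → ℝ) : Prop :=
  π ∈ stdSimplex ℝ E ∧ π ᵥ* P = π

/-- The generator `G = diag(τ) (P - I)` of the Markov environment that has routing matrix `P`
and exponential sojourn times with rates `τ`. -/
def generator {E : Type*} [Fintype E] [DecidableEq E] (P : Matrix E E ℝ) (τ : E → ℝ) :
    Matrix E E ℝ :=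
  Matrix.diagonal τ * (P - 1)

/-- `ϖ` is a stationary distribution of the continuous-time Markov chain with generator `G`. -/
def IsStationaryForGenerator {E : Type*} [Fintype E] (G : Matrix E E ℝ) (ϖ : E → ℝ) : Prop :=
  ϖ ∈ stdSimplex ℝ E ∧ ϖ ᵥ* G = 0

/-- The stationary Markov renewal sequence on the whole line with routing matrix `P`, stationary
distribution `π` of `P`, and sojourn laws `ν k` (probability measures on `(0, ∞)` with finite mean).
`S n` is the epoch at which the `n`-th sojourn starts, `X n` is the state during this sojourn, and
the sojourn number `0` is the one that covers time `0`.

In the Palm version, in which time `0` is a transition epoch, the sequence `X` is a stationary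
Markov chain with transition matrix `P` and, given `X`, the sojourn times are independent with laws
`ν (X j)`. The time-stationary version is obtained from it by Palm inversion: the weight of the
sojourn covering time `0` is proportional to its length `t`, and its age `- S 0` is then uniform on
`[0, t)`. The field `law` writes this out for the joint law of the states and of the sojourn times
number `-m, …, n` and of the age. -/
structure IsStationaryRenewal {Ω E : Type*} [MeasurableSpace Ω] [Fintype E] [MeasurableSpace E]
    (Pr : Measure Ω) (P : Matrix E E ℝ) (π : E → ℝ) (ν : E → Measure ℝ)
    (X : ℤ → Ω → E) (S : ℤ → Ω → ℝ) : Prop where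
  measurable_state : ∀ n, Measurable (X n)
  measurable_epoch : ∀ n, Measurable (S n)
  covers_zero : ∀ᵐ ω ∂Pr, S 0 ω ≤ 0 ∧ 0 < S 1 ω
  law : ∀ (m n : ℕ) (x : ℤ → E) (B : ℤ → Set ℝ) (A : Set ℝ),
    (∀ j, MeasurableSet (B j)) → MeasurableSet A →
    Pr {ω | (∀ j ∈ Finset.Icc (-(m : ℤ)) n, X j ω = x j ∧ S (j + 1) ω - S j ω ∈ B j) ∧
        - S 0 ω ∈ A} =
      (∑ k, ENNReal.ofReal (π k) * ∫⁻ t, ENNReal.ofReal t ∂(ν k))⁻¹ *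
        (ENNReal.ofReal (π (x (-(m : ℤ)))) *
          ∏ j ∈ Finset.Ico (-(m : ℤ)) n, ENNReal.ofReal (P (x j) (x (j + 1)))) *
        (∏ j ∈ (Finset.Icc (-(m : ℤ)) n).erase 0, ν (x j) (B j)) *
        ∫⁻ t in B 0, volume (A ∩ Set.Ico 0 t) ∂(ν (x 0))

/-- `Γ` is a (time-)stationary semi-Markov process on the real line, with routing matrix `P` and
sojourn-time laws `ν`. -/
def IsStationarySemiMarkov {Ω E : Type*} [MeasurableSpace Ω] [Fintype E] [MeasurableSpace E]
    (Pr : Measure Ω) (P : Matrix E E ℝ) (ν : E → Measure ℝ) (Γ : ℝ → Ω → E) : Prop :=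
  (∀ u, Measurable (Γ u)) ∧
    ∃ (π : E → ℝ) (X : ℤ → Ω → E) (S : ℤ → Ω → ℝ),
      IsStationaryDistribution P π ∧ IsStationaryRenewal Pr P π ν X S ∧
        ∀ᵐ ω ∂Pr, ∀ (n : ℤ) (u : ℝ), S n ω ≤ u → u < S (n + 1) ω → Γ u ω = X n ω

/-- The work `F_γ(u) = ∫_u^0 β_{γ(t)} dt` done by a server during `[u, 0)`, along the path `γ`. -/
def work {E : Type*} (β : E → ℝ) (γ : ℝ → E) (u : ℝ) : ℝ :=
  ∫ t in u..0, β (γ t)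

/-- The set `A_γ` of the pairs (arrival time, service request) of the customers that arrive before
time `0` and are still in the system at time `0`. -/
def presentSet {E : Type*} (β : E → ℝ) (γ : ℝ → E) : Set (ℝ × ℝ) :=
  {p | p.1 < 0 ∧ 0 < p.2 ∧ work β γ p.1 < p.2}

/-- The intensity measure `λ_γ(u) du G(dσ)` of the marked arrivals along the path `γ`, where `G` is
the exponential distribution with rate `μ`. -/
def intensity {E : Type*} (lam : E → ℝ) (μ : ℝ) (γ : ℝ → E) : Measure (ℝ × ℝ) :=
  (volume.withDensity fun u => ENNReal.ofReal (lam (γ u))).prod (expMeasure μ)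

/-- The random measure `|A_Γ|_Γ` of the random set `A_Γ`, as a function of the path. -/
def area {E : Type*} (lam β : E → ℝ) (μ : ℝ) (γ : ℝ → E) : ℝ≥0∞ :=
  intensity lam μ γ (presentSet β γ)

/-- The vector `m⁽ⁿ⁾`: its `k`-th coordinate is the `n`-th moment of `|A_Γ|_Γ` given `Γ(0) = k`. -/
def momentVec {Ω E : Type*} [MeasurableSpace Ω] (Pr : Measure Ω) (lam β : E → ℝ) (μ : ℝ)
    (Γ : ℝ → Ω → E) (n : ℕ) (k : E) : ℝ :=
  ∫ ω, (area lam β μ fun u => Γ u ω).toReal ^ n ∂(Pr[|{ω | Γ 0 ω = k}])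

end

end SemiMarkovQueue

/-! Read the past backwards from time 0. A covering sojourn of length-biased exponential length, cut
at a uniform point, has an exponential age with the original rate. Hence the unnormalised law `L k`
of the past on `Γ 0 = k` renews itself (`isBackwardLaw`): an `Exp (τ k)` time in `k`, followed by an
independent past drawn from `∑ l, (P l k * τ l / τ k) • L l`.

Integrating out the service requests turns the area into the arrivals discounted by `exp (-∫ μ β)`,
which is the limit of `accum`, one application of `step` per sojourn (`area_eq_total`). As a
function of the sojourn length, `step` solves `z' = a - b z`. Integrating the derivative of `exp (-r
t) z(t) ^ n` over the half-line gives the moment identity of one sojourn, and averaging it over the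
past gives, for `M n k = ∫ total ^ n ∂L k` and `b k = μ β k`, `(τ k + n b k) M n k = ∑ l, P l k τ l
M n l + n λ k M (n-1) k`. Since `M n k = m⁽ⁿ⁾ k * ϖ k`, this is the asserted matrix identity,
coordinate by coordinate.

The subtraction needs finite moments. Summed over `k`, the routing terms cancel because the rows of
`P` sum to one, so `∑ b k M n k` is controlled by the moments of order `n - 1`; this gives
finiteness where `b k > 0`, and irreducibility spreads it (`total_moment_lt_top`). The same summed
identity with `a = b = 1` shows that the sojourns exhaust the past (`ae_tendsto_sum`). -/

namespace SemiMarkovQueue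

/-! ### Positivity and uniqueness of invariant vectors of an irreducible matrix. -/

section Irreducible

variable {E : Type*} {P : Matrix E E ℝ}

/-- A property that passes from the target to the source of every edge of an irreducible matrix
and holds somewhere holds everywhere. -/
lemma forall_of_isIrreducible (hirr : P.IsIrreducible) {s : E → Prop} {k : E} (hk : s k)
    (h : ∀ k l, s k → 0 < P l k → s l) (l : E) : s l := by
  let : Quiver E := P.toQuiver
  obtain ⟨p, -⟩ := hirr.connected l k
  induction p with
  | nil => exact hk
  | cons q e ih => exact ih (h _ _ hk e.down)

variable [Fintype E]

lemma pos_of_vecMul_eq (hirr : P.IsIrreducible) {v : E → ℝ} (hv : ∀ k, 0 ≤ v k)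
    (hinv : v ᵥ* P = v) {k : E} (hk : 0 < v k) (l : E) : 0 < v l := by
  -- Mass flows from the source of an edge to its target, hence the transpose.
  refine forall_of_isIrreducible (P := Pᵀ) hirr.transpose (s := fun l => 0 < v l) hk ?_ l
  intro i j hi hij
  rw [← hinv]
  exact Finset.sum_pos' (fun m _ => mul_nonneg (hv m) (hirr.nonneg m j))
    ⟨i, Finset.mem_univ i, mul_pos hi hij⟩

lemma pos_of_mem_stdSimplex_of_vecMul_eq (hirr : P.IsIrreducible) {v : E → ℝ}
    (hv : v ∈ stdSimplex ℝ E) (hinv : v ᵥ* P = v) (l : E) : 0 < v l := by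
  obtain ⟨k, -, hk⟩ : ∃ k ∈ Finset.univ, (0 : ℝ) < v k := by
    apply Finset.exists_lt_of_sum_lt
    simp [hv.2]
  exact pos_of_vecMul_eq hirr hv.1 hinv hk l

/-- Invariant vectors of an irreducible matrix are proportional. -/
lemma exists_smul_eq_of_vecMul_eq (hirr : P.IsIrreducible) {v w : E → ℝ}
    (hw : ∀ k, 0 < w k) (hvinv : v ᵥ* P = v) (hwinv : w ᵥ* P = w) :
    ∃ t : ℝ, v = t • w := by
  rcases isEmpty_or_nonempty E with hE | hE
  · exact ⟨0, Subsingleton.elim _ _⟩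
  -- Subtracting from `v` the multiple of `w` with the smallest ratio leaves a nonnegative invariant
  -- vector that vanishes at `k`; were it positive anywhere, it would be positive at `k`.
  obtain ⟨k, hk⟩ := Finite.exists_min (fun k => v k / w k)
  refine ⟨v k / w k, ?_⟩
  have hu : ∀ l, 0 ≤ (v - (v k / w k) • w) l := fun l => by
    have := (le_div_iff₀ (hw l)).1 (hk l)
    simpa using this
  have huinv : (v - (v k / w k) • w) ᵥ* P = v - (v k / w k) • w := by
    rw [Matrix.sub_vecMul, Matrix.smul_vecMul, hvinv, hwinv]
  have huk : (v - (v k / w k) • w) k = 0 := by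
    simp [div_mul_cancel₀ _ (hw k).ne']
  funext l
  by_contra hne
  have hl : 0 < (v - (v k / w k) • w) l :=
    lt_of_le_of_ne (hu l) fun h0 => hne (sub_eq_zero.1 h0.symm)
  exact (pos_of_vecMul_eq hirr hu huinv hl k).ne' huk

end Irreducible

/-! ### Exponential sojourns: the law of the age and the moment identity over one sojourn. -/

section Exponential

open Set Filter Topology

lemma lintegral_expMeasure (r : ℝ) {f : ℝ → ℝ≥0∞} (hf : Measurable f) :
    ∫⁻ t, f t ∂expMeasure r = ∫⁻ t in Ioi 0, ENNReal.ofReal (r * Real.exp (-(r * t))) * f t := by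
  have hm : Measurable (exponentialPDF r) := (measurable_exponentialPDFReal r).ennreal_ofReal
  have h1 : ∫⁻ t, f t ∂expMeasure r = ∫⁻ t, exponentialPDF r t * f t := by
    change ∫⁻ t, f t ∂(volume.withDensity (exponentialPDF r)) = _
    rw [lintegral_withDensity_eq_lintegral_mul _ hm hf]
    rfl
  rw [h1, setLIntegral_congr (Ioi_ae_eq_Ici (μ := volume) (a := (0:ℝ))),
    ← lintegral_indicator measurableSet_Ici]
  congr 1 with t
  by_cases ht : 0 ≤ t
  · rw [indicator_of_mem (mem_Ici.2 ht), exponentialPDF_of_nonneg ht]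
  · rw [indicator_of_notMem (by simpa using ht), exponentialPDF_of_neg (not_le.1 ht), zero_mul]

lemma expMeasure_Ioi {r : ℝ} (hr : 0 < r) {a : ℝ} (ha : 0 ≤ a) :
    expMeasure r (Ioi a) = ENNReal.ofReal (Real.exp (-(r * a))) := by
  have := isProbabilityMeasure_expMeasure hr
  have h := cdf_expMeasure_eq hr a
  rw [if_pos ha, cdf_eq_real] at h
  rw [← compl_Iic, ← ofReal_measureReal, probReal_compl_eq_one_sub measurableSet_Iic, h]
  congr 1
  ring

lemma ae_nonneg_expMeasure {r : ℝ} (hr : 0 < r) : ∀ᵐ t ∂expMeasure r, 0 ≤ t := by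
  have := isProbabilityMeasure_expMeasure hr
  have h : expMeasure r (Ioi 0) = 1 := by simp [expMeasure_Ioi hr le_rfl]
  have h' : ∀ᵐ t ∂expMeasure r, t ∈ Ioi (0 : ℝ) := by
    rw [← mem_ae_iff_prob_eq_one measurableSet_Ioi] at h
    exact h
  filter_upwards [h'] with t ht using le_of_lt ht

/-- Under the length-biased exponential law with a uniform age, the age is exponential. -/
lemma lintegral_volume_inter_Ico_expMeasure {r : ℝ} (hr : 0 < r) {A : Set ℝ}
    (hA : MeasurableSet A) :
    ∫⁻ t, volume (A ∩ Ico 0 t) ∂expMeasure r = ENNReal.ofReal r⁻¹ * expMeasure r A := by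
  have := isProbabilityMeasure_expMeasure hr
  have hS : MeasurableSet {p : ℝ × ℝ | p.2 ∈ A ∧ 0 ≤ p.2 ∧ p.2 < p.1} :=
    (measurable_snd hA).inter ((measurableSet_le measurable_const measurable_snd).inter
      (measurableSet_lt measurable_snd measurable_fst))
  have h1 : ∫⁻ t, volume (A ∩ Ico 0 t) ∂expMeasure r =
      ((expMeasure r).prod volume) {p : ℝ × ℝ | p.2 ∈ A ∧ 0 ≤ p.2 ∧ p.2 < p.1} := by
    rw [Measure.prod_apply hS]
    rfl
  rw [h1, Measure.prod_apply_symm hS]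
  -- Tonelli: at a fixed age `a ≥ 0` the admissible lengths are `t > a`, of mass `exp (-r a)`, which
  -- is `r⁻¹` times the exponential density at `a`.
  have h2 : ∀ a, expMeasure r ((fun t => (t, a)) ⁻¹' {p : ℝ × ℝ | p.2 ∈ A ∧ 0 ≤ p.2 ∧ p.2 < p.1}) =
      ENNReal.ofReal r⁻¹ * A.indicator (exponentialPDF r) a := by
    intro a
    by_cases ha : a ∈ A ∧ 0 ≤ a
    · have : (fun t => (t, a)) ⁻¹' {p : ℝ × ℝ | p.2 ∈ A ∧ 0 ≤ p.2 ∧ p.2 < p.1} = Ioi a := by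
        ext t; simp [ha.1, ha.2]
      rw [this, expMeasure_Ioi hr ha.2, indicator_of_mem ha.1, exponentialPDF_of_nonneg ha.2,
        ← ENNReal.ofReal_mul (by positivity), inv_mul_cancel_left₀ hr.ne']
    · have : (fun t => (t, a)) ⁻¹' {p : ℝ × ℝ | p.2 ∈ A ∧ 0 ≤ p.2 ∧ p.2 < p.1} = ∅ := by
        ext t
        simp only [mem_preimage, mem_ofPred_eq, mem_empty_iff_false, iff_false]
        tauto
      rw [this, measure_empty]
      by_cases haA : a ∈ A
      · rw [indicator_of_mem haA, exponentialPDF_of_neg (not_le.1 fun h => ha ⟨haA, h⟩), mul_zero]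
      · rw [indicator_of_notMem haA, mul_zero]
  simp_rw [h2]
  rw [lintegral_const_mul' _ _ ENNReal.ofReal_ne_top, lintegral_indicator hA]
  congr 1
  change _ = (volume.withDensity (exponentialPDF r)) A
  rw [withDensity_apply _ hA]

/-- Integral of the exponential discount `exp (-b s)` over `[0, t)`. -/
noncomputable def discounted (b t : ℝ) : ℝ := ∫ s in (0 : ℝ)..t, Real.exp (-(b * s))

lemma hasDerivAt_discounted (b t : ℝ) :
    HasDerivAt (discounted b) (Real.exp (-(b * t))) t := by
  have hc : Continuous fun s : ℝ => Real.exp (-(b * s)) := by fun_prop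
  exact intervalIntegral.integral_hasDerivAt_right (hc.intervalIntegrable _ _)
    (hc.stronglyMeasurableAtFilter _ _) hc.continuousAt

lemma discounted_zero (b : ℝ) : discounted b 0 = 0 := by simp [discounted]

/-- Left undivided by `b`, so that idle servers (`b = 0`) are covered. -/
lemma mul_discounted (b t : ℝ) : b * discounted b t = 1 - Real.exp (-(b * t)) := by
  have hd : ∀ x ∈ uIcc 0 t, HasDerivAt (fun s : ℝ => -Real.exp (-(b * s)))
      (b * Real.exp (-(b * x))) x := fun x _ => hasDerivAt_neg_exp_mul_exp
  have h := intervalIntegral.integral_eq_sub_of_hasDerivAt hd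
    (Continuous.intervalIntegrable (by fun_prop) _ _)
  rw [discounted, ← intervalIntegral.integral_const_mul, h]
  simp
  ring

lemma continuous_discounted (b : ℝ) : Continuous (discounted b) :=
  continuous_iff_continuousAt.2 fun t => (hasDerivAt_discounted b t).continuousAt

lemma discounted_nonneg (b : ℝ) {t : ℝ} (ht : 0 ≤ t) : 0 ≤ discounted b t :=
  intervalIntegral.integral_nonneg ht fun _ _ => (Real.exp_pos _).le

lemma discounted_le {b t : ℝ} (hb : 0 ≤ b) (ht : 0 ≤ t) : discounted b t ≤ t := by
  have hc : Continuous fun s : ℝ => Real.exp (-(b * s)) := by fun_prop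
  have := intervalIntegral.integral_mono_on (μ := volume) ht (hc.intervalIntegrable 0 t)
    (continuous_const.intervalIntegrable (μ := volume) 0 t : IntervalIntegrable (fun _ => (1:ℝ)) volume 0 t)
    (fun s hs => Real.exp_le_one_iff.2 (neg_nonpos.2 (mul_nonneg hb hs.1)))
  simpa [discounted] using this

/-- Mean number of customers present after a sojourn of length `t` with arrival rate `a` and
service rate `b`, if there were `z` at its beginning. -/
noncomputable def step (a b t z : ℝ) : ℝ := a * discounted b t + Real.exp (-(b * t)) * z

lemma step_zero (a b z : ℝ) : step a b 0 z = z := by simp [step, discounted_zero]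

lemma step_nonneg {a t z : ℝ} (b : ℝ) (ha : 0 ≤ a) (ht : 0 ≤ t) (hz : 0 ≤ z) :
    0 ≤ step a b t z :=
  add_nonneg (mul_nonneg ha (discounted_nonneg b ht)) (mul_nonneg (Real.exp_pos _).le hz)

lemma step_mono (a b t : ℝ) {z z' : ℝ} (h : z ≤ z') : step a b t z ≤ step a b t z' := by
  unfold step
  gcongr

lemma hasDerivAt_step (a b t z : ℝ) :
    HasDerivAt (fun t => step a b t z) (a - b * step a b t z) t := by
  have he : HasDerivAt (fun t : ℝ => Real.exp (-(b * t))) (Real.exp (-(b * t)) * (-(b * 1))) t :=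
    (((hasDerivAt_id t).const_mul b).neg).exp
  refine (((hasDerivAt_discounted b t).const_mul a).add (he.mul_const z)).congr_deriv ?_
  have := mul_discounted b t
  unfold step
  linear_combination a * this

lemma continuous_step (a b z : ℝ) : Continuous fun t => step a b t z :=
  continuous_iff_continuousAt.2 fun t => (hasDerivAt_step a b t z).continuousAt

lemma measurable_step (a b : ℝ) : Measurable fun p : ℝ × ℝ => step a b p.1 p.2 := by
  unfold step
  have := (continuous_discounted b).measurable
  fun_prop

lemma step_le {a b t z : ℝ} (ha : 0 ≤ a) (hb : 0 ≤ b) (ht : 0 ≤ t) (hz : 0 ≤ z) :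
    step a b t z ≤ a * t + z := by
  have h1 := discounted_le hb ht
  have h2 : Real.exp (-(b * t)) ≤ 1 := Real.exp_le_one_iff.2 (neg_nonpos.2 (mul_nonneg hb ht))
  unfold step
  nlinarith [mul_le_mul_of_nonneg_left h1 ha]

/-- `step` grows at most linearly in `t`, so its powers cost only half of the exponential rate. The
bound serves both integrability and the vanishing boundary term at infinity. -/
lemma exists_step_pow_le {a b z r : ℝ} (ha : 0 ≤ a) (hb : 0 ≤ b) (hz : 0 ≤ z) (hr : 0 < r)
    (n : ℕ) : ∃ K : ℝ, ∀ t, 0 ≤ t →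
      Real.exp (-(r * t)) * step a b t z ^ n ≤ K * Real.exp (-(r / 2 * t)) := by
  -- Chosen so that `n * ε ≤ r / 2`; the `n + 1` keeps it meaningful for `n = 0`.
  set ε : ℝ := r / (2 * (n + 1)) with hε
  have hεpos : 0 < ε := by positivity
  refine ⟨(a / ε + z) ^ n, fun t ht => ?_⟩
  have h1 : step a b t z ≤ (a / ε + z) * Real.exp (ε * t) := by
    refine (step_le ha hb ht hz).trans ?_
    have h2 : ε * t ≤ Real.exp (ε * t) := by linarith [Real.add_one_le_exp (ε * t)]
    have h3 : 1 ≤ Real.exp (ε * t) := Real.one_le_exp (by positivity)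
    have h4 : a * t = a / ε * (ε * t) := by field_simp
    rw [h4, add_mul]
    exact add_le_add (mul_le_mul_of_nonneg_left h2 (by positivity))
      (by nlinarith)
  have h5 : (n : ℝ) * ε ≤ r / 2 := by
    rw [hε, mul_div_assoc', div_le_div_iff₀ (by positivity) (by norm_num)]
    nlinarith
  calc Real.exp (-(r * t)) * step a b t z ^ n
      ≤ Real.exp (-(r * t)) * ((a / ε + z) * Real.exp (ε * t)) ^ n := by
        gcongr
        exact step_nonneg b ha ht hz
    _ = (a / ε + z) ^ n * Real.exp (-(r * t) + n * (ε * t)) := by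
        rw [mul_pow, ← Real.exp_nat_mul, Real.exp_add]; ring
    _ ≤ (a / ε + z) ^ n * Real.exp (-(r / 2 * t)) := by
        gcongr
        nlinarith [mul_le_mul_of_nonneg_right h5 ht]

lemma integrableOn_exp_mul_step_pow {a b z r : ℝ} (ha : 0 ≤ a) (hb : 0 ≤ b) (hz : 0 ≤ z)
    (hr : 0 < r) (n : ℕ) :
    IntegrableOn (fun t => Real.exp (-(r * t)) * step a b t z ^ n) (Ioi 0) := by
  obtain ⟨K, hK⟩ := exists_step_pow_le ha hb hz hr n
  have hc := continuous_step a b z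
  have hint : IntegrableOn (fun t => K * Real.exp (-(r / 2 * t))) (Ioi 0) := by
    have := exp_neg_integrableOn_Ioi 0 (half_pos hr)
    simp only [neg_mul] at this
    exact this.const_mul K
  refine Integrable.mono' hint (by fun_prop) ?_
  filter_upwards [ae_restrict_mem measurableSet_Ioi] with t ht
  have ht' : 0 ≤ t := le_of_lt ht
  rw [Real.norm_of_nonneg (mul_nonneg (Real.exp_pos _).le
    (pow_nonneg (step_nonneg b ha ht' hz) _))]
  exact hK t ht'

/-- By the equation `z' = a - b z`, the derivative of `-exp (-r t) z ^ n` is the difference of the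
two integrands; the boundary values are `-z ^ n` at 0 and 0 at infinity. -/
lemma integral_exp_mul_step_pow {a b z r : ℝ} (ha : 0 ≤ a) (hb : 0 ≤ b) (hz : 0 ≤ z)
    (hr : 0 < r) {n : ℕ} (hn : 0 < n) :
    (r + n * b) * (∫ t in Ioi 0, Real.exp (-(r * t)) * step a b t z ^ n) =
      z ^ n + n * a * ∫ t in Ioi 0, Real.exp (-(r * t)) * step a b t z ^ (n - 1) := by
  have hd : ∀ t ∈ Ici (0 : ℝ), HasDerivAt (fun t => -(Real.exp (-(r * t)) * step a b t z ^ n))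
      ((r + n * b) * (Real.exp (-(r * t)) * step a b t z ^ n) -
        n * a * (Real.exp (-(r * t)) * step a b t z ^ (n - 1))) t := by
    intro t _
    have he : HasDerivAt (fun t : ℝ => Real.exp (-(r * t)))
        (Real.exp (-(r * t)) * (-(r * 1))) t :=
      (((hasDerivAt_id t).const_mul r).neg).exp
    refine (he.mul ((hasDerivAt_step a b t z).pow n)).neg.congr_deriv ?_
    obtain ⟨m, rfl⟩ : ∃ m, n = m + 1 := ⟨n - 1, by omega⟩
    simp only [Pi.pow_apply, Nat.add_sub_cancel, Nat.cast_add, Nat.cast_one]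
    ring
  have hi1 := (integrableOn_exp_mul_step_pow ha hb hz hr n).const_mul (r + n * b)
  have hi2 := (integrableOn_exp_mul_step_pow ha hb hz hr (n - 1)).const_mul (n * a)
  have hlim : Tendsto (fun t => -(Real.exp (-(r * t)) * step a b t z ^ n)) atTop (𝓝 0) := by
    obtain ⟨K, hK⟩ := exists_step_pow_le ha hb hz hr n
    have hz0 : Tendsto (fun t => K * Real.exp (-(r / 2 * t))) atTop (𝓝 0) := by
      have h1 : Tendsto (fun t : ℝ => r / 2 * t) atTop atTop :=
        tendsto_id.const_mul_atTop (half_pos hr)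
      simpa using (Real.tendsto_exp_neg_atTop_nhds_zero.comp h1).const_mul K
    rw [← neg_zero]
    refine Tendsto.neg (tendsto_of_tendsto_of_tendsto_of_le_of_le' tendsto_const_nhds hz0 ?_ ?_)
    · filter_upwards [eventually_ge_atTop 0] with t ht
      exact mul_nonneg (Real.exp_pos _).le (pow_nonneg (step_nonneg b ha ht hz) _)
    · filter_upwards [eventually_ge_atTop 0] with t ht using hK t ht
  have h := integral_Ioi_of_hasDerivAt_of_tendsto' hd (hi1.sub hi2) hlim
  rw [integral_sub hi1 hi2, integral_const_mul, integral_const_mul] at h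
  simp only [step_zero, mul_zero, neg_zero, Real.exp_zero, one_mul] at h
  linarith

lemma lintegral_step_pow_expMeasure {a b z r : ℝ} (ha : 0 ≤ a) (hb : 0 ≤ b) (hz : 0 ≤ z)
    (hr : 0 < r) (n : ℕ) :
    ∫⁻ t, ENNReal.ofReal (step a b t z) ^ n ∂expMeasure r =
      ENNReal.ofReal (r * ∫ t in Ioi 0, Real.exp (-(r * t)) * step a b t z ^ n) := by
  have hc := continuous_step a b z
  rw [lintegral_expMeasure r (hc.measurable.ennreal_ofReal.pow_const n), ← integral_const_mul,
    ofReal_integral_eq_lintegral_ofReal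
      ((integrableOn_exp_mul_step_pow ha hb hz hr n).const_mul r)]
  · refine setLIntegral_congr_fun measurableSet_Ioi fun t ht => ?_
    have h0 := step_nonneg b ha (le_of_lt ht) hz
    rw [← ENNReal.ofReal_pow h0, ← ENNReal.ofReal_mul (by positivity), mul_assoc]
  · filter_upwards [ae_restrict_mem measurableSet_Ioi] with t ht
    have h0 := step_nonneg b ha (le_of_lt ht) hz
    change 0 ≤ _
    positivity

/-- The moment identity over one exponential sojourn. -/
lemma mul_lintegral_step_pow {a b z r : ℝ} (ha : 0 ≤ a) (hb : 0 ≤ b) (hz : 0 ≤ z)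
    (hr : 0 < r) {n : ℕ} (hn : 0 < n) :
    ENNReal.ofReal (r + n * b) * ∫⁻ t, ENNReal.ofReal (step a b t z) ^ n ∂expMeasure r =
      ENNReal.ofReal r * ENNReal.ofReal z ^ n + ENNReal.ofReal (n * a) *
        ∫⁻ t, ENNReal.ofReal (step a b t z) ^ (n - 1) ∂expMeasure r := by
  have hI : ∀ m : ℕ, 0 ≤ ∫ t in Ioi 0, Real.exp (-(r * t)) * step a b t z ^ m := fun m =>
    setIntegral_nonneg measurableSet_Ioi fun t ht => by
      have := step_nonneg b ha (le_of_lt ht) hz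
      positivity
  rw [lintegral_step_pow_expMeasure ha hb hz hr, lintegral_step_pow_expMeasure ha hb hz hr,
    ← ENNReal.ofReal_pow hz, ← ENNReal.ofReal_mul (by positivity),
    ← ENNReal.ofReal_mul (by positivity), ← ENNReal.ofReal_mul (by positivity),
    ← ENNReal.ofReal_add (by positivity)
      (mul_nonneg (by positivity) (mul_nonneg hr.le (hI (n - 1))))]
  congr 1
  linear_combination r * integral_exp_mul_step_pow ha hb hz hr hn

end Exponential

/-! ### The backward law of the past and the recursion for its moments. -/

section Backward

open Set Filter Topology

/-- The sequence with first term `a` followed by the terms of `y`. -/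
def consSeq {α : Type*} (a : α) (y : ℕ → α) : ℕ → α
  | 0 => a
  | n + 1 => y n

lemma measurable_consSeq {α : Type*} [MeasurableSpace α] :
    Measurable fun p : α × (ℕ → α) => consSeq p.1 p.2 := by
  refine measurable_pi_iff.2 fun i => ?_
  cases i with
  | zero => exact measurable_fst
  | succ n => exact (measurable_pi_apply n).comp measurable_snd

variable {E : Type*}

/-- The discounted arrivals during the `N` most recent sojourns, for a sequence of states and
sojourn times listed backwards in time. -/
noncomputable def accum (a b : E → ℝ) : ℕ → (ℕ → E × ℝ) → ℝ
  | 0, _ => 0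
  | N + 1, y => step (a (y 0).1) (b (y 0).1) (y 0).2 (accum a b N fun i => y (i + 1))

lemma accum_nonneg {a : E → ℝ} (ha : ∀ k, 0 ≤ a k) (b : E → ℝ) (N : ℕ) {y : ℕ → E × ℝ}
    (hy : ∀ i, 0 ≤ (y i).2) : 0 ≤ accum a b N y := by
  induction N generalizing y with
  | zero => exact le_rfl
  | succ N ih => exact step_nonneg _ (ha _) (hy 0) (ih fun i => hy (i + 1))

/-- Truncating after `N` sojourns starts the iteration from 0 instead of a nonnegative value, and
`step` is monotone in its starting value. -/
lemma monotone_accum {a : E → ℝ} (ha : ∀ k, 0 ≤ a k) (b : E → ℝ) {y : ℕ → E × ℝ}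
    (hy : ∀ i, 0 ≤ (y i).2) : Monotone fun N => accum a b N y := by
  refine monotone_nat_of_le_succ fun N => ?_
  induction N generalizing y with
  | zero => exact accum_nonneg ha b 1 hy
  | succ N ih => exact step_mono _ _ _ (ih fun i => hy (i + 1))

/-- With unit rates `accum` is a bounded clock for the elapsed time; it serves to show that the
sojourns do not accumulate. -/
lemma accum_one_one (N : ℕ) (y : ℕ → E × ℝ) :
    accum (fun _ => 1) (fun _ => 1) N y = 1 - Real.exp (-∑ i ∈ Finset.range N, (y i).2) := by
  induction N generalizing y with
  | zero => simp [accum]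
  | succ N ih =>
    have h := mul_discounted 1 (y 0).2
    rw [accum, ih, step, h, Finset.sum_range_succ', neg_add, Real.exp_add]
    simp only [one_mul]
    ring

/-- The discounted arrivals during the whole past. -/
noncomputable def total (a b : E → ℝ) (y : ℕ → E × ℝ) : ℝ≥0∞ :=
  ⨆ N, ENNReal.ofReal (accum a b N y)

lemma tendsto_total {a : E → ℝ} (ha : ∀ k, 0 ≤ a k) (b : E → ℝ) {y : ℕ → E × ℝ}
    (hy : ∀ i, 0 ≤ (y i).2) :
    Tendsto (fun N => ENNReal.ofReal (accum a b N y)) atTop (𝓝 (total a b y)) :=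
  tendsto_atTop_iSup fun _ _ h => ENNReal.ofReal_le_ofReal (monotone_accum ha b hy h)

variable [Fintype E] [MeasurableSpace E] [MeasurableSingletonClass E]

@[fun_prop]
lemma measurable_accum (a b : E → ℝ) (N : ℕ) : Measurable (accum a b N) := by
  induction N with
  | zero => exact measurable_const
  | succ N ih =>
    have h : Measurable fun p : E × (ℝ × ℝ) => step (a p.1) (b p.1) p.2.1 p.2.2 :=
      measurable_from_prod_countable_right fun k => measurable_step (a k) (b k)
    have h0 : Measurable fun y : ℕ → E × ℝ => y 0 := measurable_pi_apply 0
    have hs : Measurable fun (y : ℕ → E × ℝ) (i : ℕ) => y (i + 1) :=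
      measurable_pi_iff.2 fun i => measurable_pi_apply (i + 1)
    exact h.comp (h0.fst.prodMk (h0.snd.prodMk (ih.comp hs)))

@[fun_prop]
lemma measurable_total (a b : E → ℝ) : Measurable (total a b) :=
  Measurable.iSup fun N => (measurable_accum a b N).ennreal_ofReal

omit [MeasurableSingletonClass E] in
lemma isFiniteMeasure_sum_ofReal_smul {L : E → Measure (ℕ → E × ℝ)}
    (hL : ∀ k, IsFiniteMeasure (L k)) (c : E → ℝ) :
    IsFiniteMeasure (∑ l, ENNReal.ofReal (c l) • L l) := by
  refine ⟨?_⟩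
  rw [Measure.finsetSum_apply, ENNReal.sum_lt_top]
  intro l _
  have := hL l
  exact ENNReal.mul_lt_top ENNReal.ofReal_lt_top (measure_lt_top _ _)

/-- `L k` is the law of the states and sojourn times, listed backwards in time, on the event that
the present state is `k`: it is the concatenation of an exponential time in `k` and an independent
past, whose states are obtained by reversing the routing matrix. -/
structure IsBackwardLaw (P : Matrix E E ℝ) (τ : E → ℝ) (L : E → Measure (ℕ → E × ℝ)) : Prop where
  finite : ∀ k, IsFiniteMeasure (L k)
  eq_map : ∀ k, L k = Measure.map (fun p : ℝ × (ℕ → E × ℝ) => consSeq (k, p.1) p.2)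
    ((expMeasure (τ k)).prod (∑ l, ENNReal.ofReal (P l k * τ l / τ k) • L l))

omit [Fintype E] [MeasurableSingletonClass E] in
lemma measurable_consSeq_mk (k : E) :
    Measurable fun p : ℝ × (ℕ → E × ℝ) => consSeq (k, p.1) p.2 :=
  measurable_consSeq.comp ((measurable_const.prodMk measurable_fst).prodMk measurable_snd)

namespace IsBackwardLaw

variable {P : Matrix E E ℝ} {τ : E → ℝ} {L : E → Measure (ℕ → E × ℝ)}

omit [MeasurableSingletonClass E] in
lemma isFiniteMeasure_sum (hL : IsBackwardLaw P τ L) (k : E) :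
    IsFiniteMeasure (∑ l, ENNReal.ofReal (P l k * τ l / τ k) • L l) :=
  isFiniteMeasure_sum_ofReal_smul hL.finite _

omit [MeasurableSingletonClass E] in
lemma ae_nonneg (hL : IsBackwardLaw P τ L) (hτ : ∀ k, 0 < τ k) (k : E) :
    ∀ᵐ y ∂L k, ∀ i, 0 ≤ (y i).2 := by
  rw [ae_all_iff]
  intro i
  have hm : ∀ i, MeasurableSet {y : ℕ → E × ℝ | 0 ≤ (y i).2} := fun i =>
    measurableSet_le measurable_const (measurable_pi_apply i).snd
  induction i generalizing k with
  | zero =>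
    have := hL.isFiniteMeasure_sum k
    rw [hL.eq_map k, ae_map_iff (measurable_consSeq_mk k).aemeasurable (hm 0)]
    exact Measure.quasiMeasurePreserving_fst.ae (ae_nonneg_expMeasure (hτ k))
  | succ i ih =>
    have := hL.isFiniteMeasure_sum k
    rw [hL.eq_map k, ae_map_iff (measurable_consSeq_mk k).aemeasurable (hm _)]
    refine Measure.quasiMeasurePreserving_snd.ae (p := fun y : ℕ → E × ℝ => 0 ≤ (y i).2) ?_
    rw [ae_iff, Measure.finsetSum_apply]
    exact Finset.sum_eq_zero fun l _ => ae_iff.1 (Measure.ae_smul_measure (ih l) _)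

omit [MeasurableSingletonClass E] in
lemma lintegral_eq (hL : IsBackwardLaw P τ L) (hτ : ∀ k, 0 < τ k) (k : E)
    {F : (ℕ → E × ℝ) → ℝ≥0∞} (hF : Measurable F) :
    ∫⁻ y, F y ∂L k = ∑ l, ENNReal.ofReal (P l k * τ l / τ k) *
      ∫⁻ y, ∫⁻ t, F (consSeq (k, t) y) ∂expMeasure (τ k) ∂L l := by
  have := hL.isFiniteMeasure_sum k
  have := isProbabilityMeasure_expMeasure (hτ k)
  have hFc : Measurable fun p : ℝ × (ℕ → E × ℝ) => F (consSeq (k, p.1) p.2) :=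
    hF.comp (measurable_consSeq_mk k)
  rw [hL.eq_map k, lintegral_map hF (measurable_consSeq_mk k),
    lintegral_prod_symm' _ hFc, lintegral_finsetSum_measure]
  simp_rw [lintegral_smul_measure]
  rfl

section Moments

variable {a b : E → ℝ}

/-- The one-sojourn identity, applied to the most recent sojourn and averaged over the older ones.
The routing term sees the past without that sojourn, hence `N` there and `N + 1` elsewhere. -/
lemma moment_recursion (hL : IsBackwardLaw P τ L) (hP : ∀ k l, 0 ≤ P k l) (hτ : ∀ k, 0 < τ k)
    (ha : ∀ k, 0 ≤ a k) (hb : ∀ k, 0 ≤ b k) (N : ℕ) {n : ℕ} (hn : 0 < n) (k : E) :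
    ENNReal.ofReal (τ k + n * b k) * ∫⁻ y, ENNReal.ofReal (accum a b (N + 1) y) ^ n ∂L k =
      ∑ l, ENNReal.ofReal (P l k * τ l) * ∫⁻ y, ENNReal.ofReal (accum a b N y) ^ n ∂L l +
        ENNReal.ofReal (n * a k) *
          ∫⁻ y, ENNReal.ofReal (accum a b (N + 1) y) ^ (n - 1) ∂L k := by
  have := isProbabilityMeasure_expMeasure (hτ k)
  have hm : ∀ m, Measurable fun y : ℕ → E × ℝ => ENNReal.ofReal (accum a b (N + 1) y) ^ m :=
    fun m => (measurable_accum a b (N + 1)).ennreal_ofReal.pow_const m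
  have hJ : ∀ m l, ∫⁻ y, ∫⁻ t, ENNReal.ofReal (accum a b (N + 1) (consSeq (k, t) y)) ^ m
      ∂expMeasure (τ k) ∂L l =
      ∫⁻ y, ∫⁻ t, ENNReal.ofReal (step (a k) (b k) t (accum a b N y)) ^ m
        ∂expMeasure (τ k) ∂L l := fun m l => rfl
  rw [hL.lintegral_eq hτ k (hm n), hL.lintegral_eq hτ k (hm (n - 1)), Finset.mul_sum,
    Finset.mul_sum, ← Finset.sum_add_distrib]
  refine Finset.sum_congr rfl fun l _ => ?_
  rw [hJ, hJ, mul_left_comm, ← lintegral_const_mul' _ _ ENNReal.ofReal_ne_top,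
    lintegral_congr_ae (g := fun y => ENNReal.ofReal (τ k) * ENNReal.ofReal (accum a b N y) ^ n +
      ENNReal.ofReal (n * a k) * ∫⁻ t, ENNReal.ofReal (step (a k) (b k) t (accum a b N y)) ^ (n - 1)
        ∂expMeasure (τ k)),
    lintegral_add_left (by fun_prop), lintegral_const_mul' _ _ ENNReal.ofReal_ne_top,
    lintegral_const_mul' _ _ ENNReal.ofReal_ne_top, mul_add, ← mul_assoc,
    ← ENNReal.ofReal_mul (div_nonneg (mul_nonneg (hP l k) (hτ l).le) (hτ k).le),
    div_mul_cancel₀ _ (hτ k).ne', mul_left_comm (ENNReal.ofReal (n * a k))]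
  filter_upwards [hL.ae_nonneg hτ l] with y hy
  exact mul_lintegral_step_pow (ha k) (hb k) (accum_nonneg ha b N hy) (hτ k) hn

lemma tendsto_moment (hL : IsBackwardLaw P τ L) (hτ : ∀ k, 0 < τ k)
    (ha : ∀ k, 0 ≤ a k) (b : E → ℝ) (n : ℕ) (k : E) :
    Tendsto (fun N => ∫⁻ y, ENNReal.ofReal (accum a b N y) ^ n ∂L k) atTop
      (𝓝 (∫⁻ y, total a b y ^ n ∂L k)) := by
  refine lintegral_tendsto_of_tendsto_of_monotone (fun N => by fun_prop) ?_ ?_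
  · filter_upwards [hL.ae_nonneg hτ k] with y hy N N' h
    exact pow_le_pow_left' (ENNReal.ofReal_le_ofReal (monotone_accum ha b hy h)) n
  · filter_upwards [hL.ae_nonneg hτ k] with y hy
    exact (ENNReal.continuous_pow n).continuousAt.tendsto.comp (tendsto_total ha b hy)

omit [MeasurableSingletonClass E] in
lemma moment_mono (hL : IsBackwardLaw P τ L) (hτ : ∀ k, 0 < τ k)
    (ha : ∀ k, 0 ≤ a k) (b : E → ℝ) (n : ℕ) (k : E) :
    Monotone fun N => ∫⁻ y, ENNReal.ofReal (accum a b N y) ^ n ∂L k := by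
  intro N N' h
  refine lintegral_mono_ae ?_
  filter_upwards [hL.ae_nonneg hτ k] with y hy
  exact pow_le_pow_left' (ENNReal.ofReal_le_ofReal (monotone_accum ha b hy h)) n

/-- Monotone limit of the truncated recursion. In `ℝ≥0∞` and without subtraction it needs no
finiteness, and so is available for proving it. -/
lemma total_moment_recursion (hL : IsBackwardLaw P τ L) (hP : ∀ k l, 0 ≤ P k l)
    (hτ : ∀ k, 0 < τ k) (ha : ∀ k, 0 ≤ a k) (hb : ∀ k, 0 ≤ b k) {n : ℕ} (hn : 0 < n) (k : E) :
    ENNReal.ofReal (τ k + n * b k) * ∫⁻ y, total a b y ^ n ∂L k =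
      ∑ l, ENNReal.ofReal (P l k * τ l) * ∫⁻ y, total a b y ^ n ∂L l +
        ENNReal.ofReal (n * a k) * ∫⁻ y, total a b y ^ (n - 1) ∂L k := by
  have h := fun m l => hL.tendsto_moment hτ ha b m l
  have hl := ENNReal.Tendsto.const_mul ((h n k).comp (tendsto_add_atTop_nat 1))
    (Or.inr (ENNReal.ofReal_ne_top (r := τ k + n * b k)))
  have hr := (tendsto_finsetSum Finset.univ fun l _ => ENNReal.Tendsto.const_mul (h n l)
    (Or.inr (ENNReal.ofReal_ne_top (r := P l k * τ l)))).add
    (ENNReal.Tendsto.const_mul ((h (n - 1) k).comp (tendsto_add_atTop_nat 1))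
    (Or.inr (ENNReal.ofReal_ne_top (r := n * a k))))
  refine tendsto_nhds_unique hl (hr.congr fun N => ?_)
  exact (hL.moment_recursion hP hτ ha hb N hn k).symm

/-- Finiteness for truncated pasts, by induction on the order and then on the truncation; it
licenses the cancellation in `total_moment_lt_top`. -/
lemma moment_lt_top (hL : IsBackwardLaw P τ L) (hP : ∀ k l, 0 ≤ P k l) (hτ : ∀ k, 0 < τ k)
    (ha : ∀ k, 0 ≤ a k) (hb : ∀ k, 0 ≤ b k) (n N : ℕ) (k : E) :
    ∫⁻ y, ENNReal.ofReal (accum a b N y) ^ n ∂L k < ⊤ := by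
  induction n generalizing N k with
  | zero =>
    have := hL.finite k
    simp
  | succ n ihn =>
    induction N generalizing k with
    | zero => simp [accum]
    | succ N ih =>
      have h := hL.moment_recursion hP hτ ha hb N n.succ_pos k
      have hpos : 0 < τ k + (n + 1 : ℕ) * b k :=
        add_pos_of_pos_of_nonneg (hτ k) (mul_nonneg (Nat.cast_nonneg _) (hb k))
      refine ENNReal.lt_top_of_mul_ne_top_right (a := ENNReal.ofReal (τ k + (n + 1 : ℕ) * b k))
        ?_ (ENNReal.ofReal_pos.2 hpos).ne'
      rw [Nat.succ_eq_add_one] at h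
      rw [h]
      refine (ENNReal.add_lt_top.2 ⟨ENNReal.sum_lt_top.2 fun l _ => ?_, ?_⟩).ne
      · exact ENNReal.mul_lt_top ENNReal.ofReal_lt_top (ih l)
      · exact ENNReal.mul_lt_top ENNReal.ofReal_lt_top (ihn (N + 1) k)

omit [MeasurableSpace E] [MeasurableSingletonClass E] in
lemma sum_sum_rate_mul (hP : ∀ k l, 0 ≤ P k l) (hsum : ∀ k, ∑ l, P k l = 1)
    (hτ : ∀ k, 0 < τ k) (u : E → ℝ≥0∞) :
    ∑ k, ∑ l, ENNReal.ofReal (P l k * τ l) * u l = ∑ l, ENNReal.ofReal (τ l) * u l := by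
  rw [Finset.sum_comm]
  refine Finset.sum_congr rfl fun l _ => ?_
  rw [← Finset.sum_mul, ← ENNReal.ofReal_sum_of_nonneg fun k _ => mul_nonneg (hP l k) (hτ l).le,
    ← Finset.sum_mul, hsum, one_mul]

lemma total_moment_lt_top (hL : IsBackwardLaw P τ L) (hirr : P.IsIrreducible)
    (hsum : ∀ k, ∑ l, P k l = 1) (hτ : ∀ k, 0 < τ k)
    (ha : ∀ k, 0 ≤ a k) (hb : ∀ k, 0 ≤ b k) (hbpos : ∃ k, 0 < b k) (n : ℕ) (k : E) :
    ∫⁻ y, total a b y ^ n ∂L k < ⊤ := by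
  have hP := hirr.nonneg
  induction n generalizing k with
  | zero =>
    have := hL.finite k
    simp
  | succ n ih =>
    obtain ⟨k₀, hk₀⟩ := hbpos
    have hnb : ∀ k, 0 ≤ (n + 1 : ℕ) * b k := fun k => mul_nonneg (Nat.cast_nonneg _) (hb k)
    refine forall_of_isIrreducible hirr (k := k₀)
      (s := fun k => ∫⁻ y, total a b y ^ (n + 1) ∂L k < ⊤) ?_ ?_ k
    -- Sum the truncated recursion over all states. The routing terms reduce to `∑ τ l * M`, which
    -- is at most the corresponding sum at `N + 1` and cancels; what remains is a bound uniform in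
    -- `N`.
    · have hbound : ∀ N, ENNReal.ofReal ((n + 1 : ℕ) * b k₀) *
          ∫⁻ y, ENNReal.ofReal (accum a b (N + 1) y) ^ (n + 1) ∂L k₀ ≤
          ∑ k, ENNReal.ofReal ((n + 1 : ℕ) * a k) * ∫⁻ y, total a b y ^ n ∂L k := by
        intro N
        have h1 := Finset.sum_congr rfl fun k (_ : k ∈ Finset.univ) =>
          hL.moment_recursion hP hτ ha hb N n.succ_pos k
        rw [Finset.sum_add_distrib, sum_sum_rate_mul hP hsum hτ] at h1
        simp_rw [Nat.succ_eq_add_one, ENNReal.ofReal_add (hτ _).le (hnb _), add_mul] at h1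
        rw [Finset.sum_add_distrib] at h1
        have h2 : ∑ l, ENNReal.ofReal (τ l) * ∫⁻ y, ENNReal.ofReal (accum a b N y) ^ (n + 1) ∂L l ≤
            ∑ l, ENNReal.ofReal (τ l) *
              ∫⁻ y, ENNReal.ofReal (accum a b (N + 1) y) ^ (n + 1) ∂L l :=
          Finset.sum_le_sum fun l _ =>
            mul_le_mul_right (hL.moment_mono hτ ha b (n + 1) l N.le_succ) _
        have h3 : ∑ l, ENNReal.ofReal (τ l) *
            ∫⁻ y, ENNReal.ofReal (accum a b (N + 1) y) ^ (n + 1) ∂L l ≠ ⊤ :=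
          (ENNReal.sum_lt_top.2 fun l _ => ENNReal.mul_lt_top ENNReal.ofReal_lt_top
            (hL.moment_lt_top hP hτ ha hb (n + 1) (N + 1) l)).ne
        have h4 := (ENNReal.add_le_add_iff_left h3).1 (h1.le.trans (add_le_add_left h2 _))
        refine (Finset.single_le_sum (f := fun k => ENNReal.ofReal ((n + 1 : ℕ) * b k) *
          ∫⁻ y, ENNReal.ofReal (accum a b (N + 1) y) ^ (n + 1) ∂L k) (fun _ _ => zero_le)
          (Finset.mem_univ k₀)).trans (h4.trans (Finset.sum_le_sum fun k _ => ?_))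
        exact mul_le_mul_right ((hL.moment_mono hτ ha b n k).ge_of_tendsto
          (hL.tendsto_moment hτ ha b n k) (N + 1)) _
      have hlim := le_of_tendsto' (ENNReal.Tendsto.const_mul
        ((hL.tendsto_moment hτ ha b (n + 1) k₀).comp (tendsto_add_atTop_nat 1))
        (Or.inr (ENNReal.ofReal_ne_top (r := (n + 1 : ℕ) * b k₀)))) hbound
      refine ENNReal.lt_top_of_mul_ne_top_right (hlim.trans_lt ?_).ne
        (ENNReal.ofReal_pos.2 (mul_pos (by positivity) hk₀)).ne'
      exact ENNReal.sum_lt_top.2 fun k _ => ENNReal.mul_lt_top ENNReal.ofReal_lt_top (ih k)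
    -- In the recursion at `k`, the moment at each predecessor `l` enters with the positive
    -- coefficient `P l k * τ l`, so finiteness passes from `k` to `l`.
    · intro k l hk hlk
      have h := hL.total_moment_recursion hP hτ ha hb n.succ_pos k
      have h1 : ENNReal.ofReal (P l k * τ l) * ∫⁻ y, total a b y ^ (n + 1) ∂L l ≤
          ENNReal.ofReal (τ k + (n + 1 : ℕ) * b k) * ∫⁻ y, total a b y ^ (n + 1) ∂L k := by
        rw [Nat.succ_eq_add_one] at h
        rw [h]
        exact (Finset.single_le_sum (f := fun l => ENNReal.ofReal (P l k * τ l) *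
          ∫⁻ y, total a b y ^ (n + 1) ∂L l) (fun _ _ => zero_le)
          (Finset.mem_univ l)).trans le_self_add
      exact ENNReal.lt_top_of_mul_ne_top_right
        (h1.trans_lt (ENNReal.mul_lt_top ENNReal.ofReal_lt_top hk)).ne
        (ENNReal.ofReal_pos.2 (mul_pos hlk (hτ l))).ne'

end Moments

/-- The sojourns fill the whole past. -/
lemma ae_tendsto_sum (hL : IsBackwardLaw P τ L) (hP : ∀ k l, 0 ≤ P k l)
    (hsum : ∀ k, ∑ l, P k l = 1) (hτ : ∀ k, 0 < τ k) (k : E) :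
    ∀ᵐ y ∂L k, Tendsto (fun N => ∑ i ∈ Finset.range N, (y i).2) atTop atTop := by
  have hone : ∀ _ : E, (0 : ℝ) ≤ 1 := fun _ => zero_le_one
  -- For unit rates `total` is `1 - exp (-T)`, with `T` the total elapsed time; it suffices to show
  -- that it equals 1 almost everywhere.
  have hle : ∀ y : ℕ → E × ℝ, total (fun _ => 1) (fun _ => 1) y ≤ 1 := fun y =>
    iSup_le fun N => by
      rw [accum_one_one, ← ENNReal.ofReal_one]
      exact ENNReal.ofReal_le_ofReal (by linarith [Real.exp_pos (-∑ i ∈ Finset.range N, (y i).2)])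
  have hU : ∀ l, ∫⁻ y, total (fun _ => 1) (fun _ => 1) y ∂L l ≤ L l univ := fun l => by
    simpa using lintegral_mono (μ := L l) hle
  have hUtop : ∀ l, ∫⁻ y, total (fun _ => 1) (fun _ => 1) y ∂L l < ⊤ := fun l =>
    have := hL.finite l
    (hU l).trans_lt (measure_lt_top _ _)
  have h1 := Finset.sum_congr rfl fun k (_ : k ∈ Finset.univ) =>
    hL.total_moment_recursion hP hτ hone hone one_pos k
  rw [Finset.sum_add_distrib, sum_sum_rate_mul hP hsum hτ] at h1
  simp only [Nat.cast_one, mul_one, pow_one, ENNReal.ofReal_one, one_mul, Nat.sub_self, pow_zero,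
    lintegral_one, ENNReal.ofReal_add (hτ _).le zero_le_one, add_mul] at h1
  rw [Finset.sum_add_distrib] at h1
  have h2 : ∑ l, ∫⁻ y, total (fun _ => 1) (fun _ => 1) y ∂L l = ∑ l, L l univ :=
    (ENNReal.add_right_inj (ENNReal.sum_lt_top.2 fun l _ =>
      ENNReal.mul_lt_top ENNReal.ofReal_lt_top (hUtop l)).ne).1 h1
  -- Each integral is at most the mass of its law and the sums over the states agree by `h2`, so
  -- equality holds in each state.
  have h3 : L k univ ≤ ∫⁻ y, total (fun _ => 1) (fun _ => 1) y ∂L k := by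
    classical
    rw [← Finset.add_sum_erase _ _ (Finset.mem_univ k),
      ← Finset.add_sum_erase _ _ (Finset.mem_univ k)] at h2
    refine (ENNReal.add_le_add_iff_right (ENNReal.sum_lt_top.2 fun l _ => hUtop l).ne).1
      ((add_le_add_right (Finset.sum_le_sum fun l _ => hU l) _).trans h2.ge)
  have h4 : (fun y => total (fun _ => 1) (fun _ => 1) y) =ᵐ[L k] fun _ => (1 : ℝ≥0∞) :=
    ae_eq_of_ae_le_of_lintegral_le (Eventually.of_forall hle) (hUtop k).ne aemeasurable_const
      (by simpa using h3)
  filter_upwards [h4, hL.ae_nonneg hτ k] with y hy hnn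
  have h5 := tendsto_total hone (fun _ => 1) hnn
  rw [hy] at h5
  have h6 := (ENNReal.tendsto_toReal ENNReal.one_ne_top).comp h5
  have h7 : Tendsto (fun N => Real.exp (-∑ i ∈ Finset.range N, (y i).2)) atTop (𝓝 0) := by
    have h8 := (tendsto_const_nhds (x := (1 : ℝ))).sub h6
    simp only [ENNReal.toReal_one, sub_self] at h8
    refine h8.congr fun N => ?_
    rw [Function.comp_apply, ENNReal.toReal_ofReal (accum_nonneg hone _ N hnn), accum_one_one]
    ring
  exact tendsto_neg_atBot_iff.1 (Real.tendsto_exp_comp_nhds_zero.1 h7)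

end IsBackwardLaw

end Backward

/-! ### Finite measures on state–sojourn sequences are determined by cylinders. -/

section Cylinders

open Set

variable {E : Type*}

/-- The sequences whose terms up to `m` have states `x i` and sojourn times in `B i`. -/
def cyl (m : ℕ) (x : ℕ → E) (B : ℕ → Set ℝ) : Set (ℕ → E × ℝ) :=
  {y | ∀ i ≤ m, (y i).1 = x i ∧ (y i).2 ∈ B i}

lemma mem_cyl {m : ℕ} {x : ℕ → E} {B : ℕ → Set ℝ} {y : ℕ → E × ℝ} :
    y ∈ cyl m x B ↔ ∀ i ≤ m, (y i).1 = x i ∧ (y i).2 ∈ B i := Iff.rfl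

lemma consSeq_mem_cyl {m : ℕ} {x : ℕ → E} {B : ℕ → Set ℝ} {p : E × ℝ} {y : ℕ → E × ℝ} :
    consSeq p y ∈ cyl (m + 1) x B ↔ (p.1 = x 0 ∧ p.2 ∈ B 0) ∧
      y ∈ cyl m (fun i => x (i + 1)) fun i => B (i + 1) := by
  simp only [mem_cyl]
  constructor
  · exact fun h => ⟨h 0 (Nat.zero_le _), fun i hi => h (i + 1) (by omega)⟩
  · rintro ⟨h0, h⟩ i hi
    cases i with
    | zero => exact h0
    | succ i => exact h i (by omega)

/-- The cylinders that fix at least two states. -/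
def cylinders (E : Type*) : Set (Set (ℕ → E × ℝ)) :=
  {s | ∃ m x B, (∀ i, MeasurableSet (B i)) ∧ s = cyl (m + 1) x B}

lemma isPiSystem_cylinders : IsPiSystem (cylinders E) := by
  rintro _ ⟨m, x, B, hB, rfl⟩ _ ⟨m', x', B', hB', rfl⟩ ⟨y, hy, hy'⟩
  classical
  -- The common point `y` supplies the states of the intersection; beyond its own range each
  -- cylinder imposes no condition on the times.
  refine ⟨max m m', fun i => (y i).1, fun i => (if i ≤ m + 1 then B i else univ) ∩
    (if i ≤ m' + 1 then B' i else univ), fun i => ?_, ?_⟩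
  · refine MeasurableSet.inter ?_ ?_ <;> split_ifs
    exacts [hB i, MeasurableSet.univ, hB' i, MeasurableSet.univ]
  · ext z
    constructor
    · rintro ⟨h, h'⟩ i hi
      refine ⟨?_, ?_, ?_⟩
      · rcases le_total m m' with hm | hm
        · exact (h' i (by omega)).1.trans (hy' i (by omega)).1.symm
        · exact (h i (by omega)).1.trans (hy i (by omega)).1.symm
      · split_ifs with hi'
        exacts [(h i hi').2, mem_univ _]
      · split_ifs with hi'
        exacts [(h' i hi').2, mem_univ _]
    · intro h
      constructor
      · intro i hi
        obtain ⟨h1, h2, -⟩ := h i (by omega)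
        rw [if_pos hi] at h2
        exact ⟨h1.trans (hy i hi).1, h2⟩
      · intro i hi
        obtain ⟨h1, -, h2⟩ := h i (by omega)
        rw [if_pos hi] at h2
        exact ⟨h1.trans (hy' i hi).1, h2⟩

variable [MeasurableSpace E] [MeasurableSingletonClass E]

lemma measurableSet_cyl (m : ℕ) (x : ℕ → E) {B : ℕ → Set ℝ} (hB : ∀ i, MeasurableSet (B i)) :
    MeasurableSet (cyl m x B) := by
  have : cyl m x B = ⋂ i, ⋂ (_ : i ≤ m), (fun y : ℕ → E × ℝ => y i) ⁻¹' ({x i} ×ˢ B i) := by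
    ext y
    simp [mem_cyl]
  rw [this]
  exact MeasurableSet.iInter fun i => MeasurableSet.iInter fun _ =>
    measurable_pi_apply i ((measurableSet_singleton _).prod (hB i))

variable [Finite E]

lemma generateFrom_cylinders :
    (inferInstance : MeasurableSpace (ℕ → E × ℝ)) = MeasurableSpace.generateFrom (cylinders E) := by
  classical
  apply le_antisymm
  · refine iSup_le fun i => ?_
    rintro _ ⟨U, hU, rfl⟩
    rcases isEmpty_or_nonempty E with hE | hE
    · have : (fun y : ℕ → E × ℝ => y i) ⁻¹' U = ∅ := by
        ext y
        exact hE.elim (y 0).1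
      rw [this]
      exact @MeasurableSet.empty _ (MeasurableSpace.generateFrom (cylinders E))
    obtain ⟨e⟩ := hE
    -- A coordinate event is a finite union over the words of the first `i + 2` states. The state
    -- `e` only fills indices that the cylinder ignores.
    have : (fun y : ℕ → E × ℝ => y i) ⁻¹' U = ⋃ x : Fin (i + 2) → E,
        cyl (i + 1) (fun j => if h : j < i + 2 then x ⟨j, h⟩ else e)
          (fun j => if j = i then {t | (x ⟨i, by omega⟩, t) ∈ U} else univ) := by
      ext y
      simp only [mem_preimage, mem_iUnion, mem_cyl]
      constructor
      · intro hy
        refine ⟨fun j => (y j).1, fun j hj => ⟨?_, ?_⟩⟩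
        · rw [dif_pos (by omega)]
        · split_ifs with hji
          · subst hji
            exact hy
          · exact mem_univ _
      · rintro ⟨x, hx⟩
        obtain ⟨h1, h2⟩ := hx i (by omega)
        rw [dif_pos (by omega)] at h1
        rw [if_pos rfl, mem_ofPred_eq, ← h1] at h2
        exact h2
    rw [this]
    refine @MeasurableSet.iUnion _ _ (MeasurableSpace.generateFrom (cylinders E)) _ _ fun x => ?_
    refine MeasurableSpace.measurableSet_generateFrom ⟨i, _, _, fun j => ?_, rfl⟩
    split_ifs
    · exact measurable_prodMk_left hU
    · exact MeasurableSet.univ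
  · refine MeasurableSpace.generateFrom_le ?_
    rintro _ ⟨m, x, B, hB, rfl⟩
    exact measurableSet_cyl _ _ hB

/-- The index `m + 1` ensures that a cylinder `cyl m` remains once the most recent sojourn is split
off. -/
lemma measure_ext_of_cyl {ρ ρ' : Measure (ℕ → E × ℝ)} [IsFiniteMeasure ρ]
    (h : ∀ m x B, (∀ i, MeasurableSet (B i)) → ρ (cyl (m + 1) x B) = ρ' (cyl (m + 1) x B)) :
    ρ = ρ' := by
  refine Measure.ext_of_generateFrom_of_cover_subset generateFrom_cylinders isPiSystem_cylinders
    (T := range fun p : E × E => cyl 1 (fun i => if i = 0 then p.1 else p.2) fun _ => univ)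
    ?_ (countable_range _) ?_ (fun s _ => measure_ne_top ρ s) ?_
  · rintro _ ⟨p, rfl⟩
    exact ⟨0, _, _, fun _ => MeasurableSet.univ, rfl⟩
  · refine eq_univ_of_forall fun y => ⟨_, ⟨((y 0).1, (y 1).1), rfl⟩, fun i hi => ⟨?_, mem_univ _⟩⟩
    interval_cases i <;> simp
  · rintro _ ⟨m, x, B, hB, rfl⟩
    exact h m x B hB

end Cylinders

/-! ### The past of the stationary renewal sequence follows the backward law. -/

section Renewal

open Set

variable {Ω E : Type*}

/-- The epochs `0, S 0, S (-1), …`. -/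
def pastEpoch (S : ℤ → Ω → ℝ) (ω : Ω) : ℕ → ℝ
  | 0 => 0
  | i + 1 => S (-i) ω

/-- The states and sojourn times before time `0`, listed backwards in time; the sojourn that
covers `0` is represented by its age. -/
def past (X : ℤ → Ω → E) (S : ℤ → Ω → ℝ) (ω : Ω) (i : ℕ) : E × ℝ :=
  (X (-i) ω, pastEpoch S ω i - pastEpoch S ω (i + 1))

variable [MeasurableSpace Ω] [Fintype E] [MeasurableSpace E]

/-- The law of the past on the event that the present state is `k`. -/
noncomputable def pastLaw (Pr : Measure Ω) (X : ℤ → Ω → E) (S : ℤ → Ω → ℝ) (k : E) :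
    Measure (ℕ → E × ℝ) :=
  (Pr.restrict {ω | X 0 ω = k}).map (past X S)

namespace IsStationaryRenewal

variable {Pr : Measure Ω} {P : Matrix E E ℝ} {π : E → ℝ} {τ : E → ℝ}
  {X : ℤ → Ω → E} {S : ℤ → Ω → ℝ}

lemma measurable_past {ν : E → Measure ℝ} (h : IsStationaryRenewal Pr P π ν X S) :
    Measurable (past X S) := by
  have hE : ∀ i, Measurable fun ω => pastEpoch S ω i := fun i => by
    cases i with
    | zero => exact measurable_const
    | succ i => exact h.measurable_epoch _
  exact measurable_pi_iff.2 fun i => (h.measurable_state _).prodMk ((hE i).sub (hE (i + 1)))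

lemma measure_past_mem_cyl (h : IsStationaryRenewal Pr P π (fun k => expMeasure (τ k)) X S)
    (hτ : ∀ k, 0 < τ k) (m : ℕ) (x : ℕ → E) {B : ℕ → Set ℝ} (hB : ∀ i, MeasurableSet (B i)) :
    Pr (past X S ⁻¹' cyl m x B) =
      (∑ k, ENNReal.ofReal (π k) * ENNReal.ofReal (τ k)⁻¹)⁻¹ *
        (ENNReal.ofReal (π (x m)) * ∏ i ∈ Finset.range m, ENNReal.ofReal (P (x (i + 1)) (x i))) *
        (∏ i ∈ Finset.range m, expMeasure (τ (x (i + 1))) (B (i + 1))) *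
        (ENNReal.ofReal (τ (x 0))⁻¹ * expMeasure (τ (x 0)) (B 0)) := by
  classical
  -- The window ends at the covering sojourn. Its full length is left free (`univ` at `j = 0`), and
  -- `B 0` constrains its age.
  have hlaw := h.law m 0 (fun j => x (-j).toNat)
    (fun j => if j = 0 then univ else B (-j).toNat) (B 0)
    (fun j => by split_ifs; exacts [MeasurableSet.univ, hB _]) (hB 0)
  have hset : past X S ⁻¹' cyl m x B =
      {ω | (∀ j ∈ Finset.Icc (-(m : ℤ)) (0 : ℕ), X j ω = x (-j).toNat ∧
        S (j + 1) ω - S j ω ∈ if j = 0 then univ else B (-j).toNat) ∧ - S 0 ω ∈ B 0} := by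
    ext ω
    simp only [mem_preimage, mem_cyl, mem_ofPred_eq, Finset.mem_Icc]
    constructor
    · intro hω
      refine ⟨fun j hj => ?_, ?_⟩
      · obtain ⟨i, rfl⟩ : ∃ i : ℕ, j = -i := ⟨(-j).toNat, by omega⟩
        have hi := hω i (by omega)
        cases i with
        | zero => simpa [past] using hi.1
        | succ i =>
          rw [if_neg (by omega), show (- -((i + 1 : ℕ) : ℤ)).toNat = i + 1 by omega,
            show -((i + 1 : ℕ) : ℤ) + 1 = -i by push_cast; ring]
          exact hi
      · simpa [past, pastEpoch] using (hω 0 (Nat.zero_le _)).2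
    · rintro ⟨h1, h2⟩ i hi
      have hi' := h1 (-i) (by omega)
      cases i with
      | zero =>
        refine ⟨by simpa [past] using hi'.1, by simpa [past, pastEpoch] using h2⟩
      | succ i =>
        rw [if_neg (by omega), show (- -((i + 1 : ℕ) : ℤ)).toNat = i + 1 by omega,
          show -((i + 1 : ℕ) : ℤ) + 1 = -i by push_cast; ring] at hi'
        exact hi'
  have hmean : ∀ k, ∫⁻ t, ENNReal.ofReal t ∂expMeasure (τ k) = ENNReal.ofReal (τ k)⁻¹ := fun k => by
    have := isProbabilityMeasure_expMeasure (hτ k)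
    simpa using lintegral_volume_inter_Ico_expMeasure (hτ k) MeasurableSet.univ
  -- Reindexing by `j = -(i + 1)`: a forward step from `j` to `j + 1` is a backward step from `i` to
  -- `i + 1`.
  have hprod1 : ∏ j ∈ Finset.Ico (-(m : ℤ)) (0 : ℕ),
      ENNReal.ofReal (P (x (-j).toNat) (x (-(j + 1)).toNat)) =
      ∏ i ∈ Finset.range m, ENNReal.ofReal (P (x (i + 1)) (x i)) := by
    refine Finset.prod_nbij' (fun j => (-(j + 1)).toNat) (fun i => -(i : ℤ) - 1) ?_ ?_ ?_ ?_ ?_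
    · intro j hj; simp at hj ⊢; omega
    · intro i hi; simp at hi ⊢; omega
    · intro j hj; simp at hj ⊢; omega
    · intro i hi; simp
    · intro j hj
      rw [show (-j).toNat = (-(j + 1)).toNat + 1 by simp at hj; omega]
  have hprod2 : ∏ j ∈ (Finset.Icc (-(m : ℤ)) (0 : ℕ)).erase 0,
      expMeasure (τ (x (-j).toNat)) (if j = 0 then univ else B (-j).toNat) =
      ∏ i ∈ Finset.range m, expMeasure (τ (x (i + 1))) (B (i + 1)) := by
    refine Finset.prod_nbij' (fun j => (-(j + 1)).toNat) (fun i => -(i : ℤ) - 1) ?_ ?_ ?_ ?_ ?_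
    · intro j hj; simp at hj ⊢; omega
    · intro i hi; simp at hi ⊢; omega
    · intro j hj; simp at hj ⊢; omega
    · intro i hi; simp
    · intro j hj
      rw [show (-j).toNat = (-(j + 1)).toNat + 1 by simp at hj; omega,
        if_neg (Finset.ne_of_mem_erase hj)]
  rw [hset, hlaw, hprod1, hprod2]
  simp only [hmean, if_true, Measure.restrict_univ, neg_zero, Int.toNat_zero, neg_neg,
    Int.toNat_natCast, lintegral_volume_inter_Ico_expMeasure (hτ _) (hB 0)]

lemma measure_state_zero (h : IsStationaryRenewal Pr P π (fun k => expMeasure (τ k)) X S)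
    (hτ : ∀ k, 0 < τ k) (k : E) :
    Pr {ω | X 0 ω = k} = (∑ l, ENNReal.ofReal (π l) * ENNReal.ofReal (τ l)⁻¹)⁻¹ *
      (ENNReal.ofReal (π k) * ENNReal.ofReal (τ k)⁻¹) := by
  have hm := h.measure_past_mem_cyl hτ 0 (fun _ => k) (B := fun _ => univ)
    fun _ => MeasurableSet.univ
  have := isProbabilityMeasure_expMeasure (hτ k)
  have hset : past X S ⁻¹' cyl 0 (fun _ => k) (fun _ => univ) = {ω | X 0 ω = k} := by
    ext ω
    simp [mem_cyl, past]
  rw [hset] at hm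
  rw [hm]
  simp [mul_assoc]

variable [MeasurableSingletonClass E]

lemma pastLaw_cyl (h : IsStationaryRenewal Pr P π (fun k => expMeasure (τ k)) X S)
    (k : E) (m : ℕ) (x : ℕ → E) {B : ℕ → Set ℝ} (hB : ∀ i, MeasurableSet (B i)) :
    (x 0 = k → pastLaw Pr X S k (cyl m x B) = Pr (past X S ⁻¹' cyl m x B)) ∧
      (x 0 ≠ k → pastLaw Pr X S k (cyl m x B) = 0) := by
  have hmeas : pastLaw Pr X S k (cyl m x B) =
      Pr (past X S ⁻¹' cyl m x B ∩ {ω | X 0 ω = k}) := by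
    rw [pastLaw, Measure.map_apply h.measurable_past (measurableSet_cyl m x hB),
      Measure.restrict_apply (h.measurable_past (measurableSet_cyl m x hB))]
  have hX : ∀ ω ∈ past X S ⁻¹' cyl m x B, X 0 ω = x 0 := fun ω hω => by
    simpa [past] using (hω 0 (Nat.zero_le _)).1
  rw [hmeas]
  constructor
  · rintro rfl
    exact congrArg Pr (inter_eq_left.2 hX)
  · intro hne
    rw [show past X S ⁻¹' cyl m x B ∩ {ω | X 0 ω = k} = ∅ from ?_, measure_empty]
    ext ω
    simp only [mem_inter_iff, mem_empty_iff_false, iff_false, not_and]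
    exact fun hω hk => hne ((hX ω hω).symm.trans hk)

/-- `L k` has mass proportional to `π k / τ k`. Multiplying the reversed routing probability `π l *
P l k / π k` by the ratio of the masses of `L k` and `L l` gives `P l k * τ l / τ k`, from which `π`
has disappeared. -/
lemma isBackwardLaw [IsFiniteMeasure Pr]
    (h : IsStationaryRenewal Pr P π (fun k => expMeasure (τ k)) X S)
    (hP : ∀ k l, 0 ≤ P k l) (hτ : ∀ k, 0 < τ k) :
    IsBackwardLaw P τ (pastLaw Pr X S) := by
  have hfin : ∀ k, IsFiniteMeasure (pastLaw Pr X S k) := fun k => by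
    unfold pastLaw; infer_instance
  refine ⟨hfin, fun k => ?_⟩
  have := isProbabilityMeasure_expMeasure (hτ k)
  have := isFiniteMeasure_sum_ofReal_smul hfin fun l => P l k * τ l / τ k
  refine measure_ext_of_cyl fun m x B hB => ?_
  have hB' : ∀ i, MeasurableSet (B (i + 1)) := fun i => hB (i + 1)
  have hmeas := measurableSet_cyl (m + 1) x hB
  rw [Measure.map_apply (measurable_consSeq_mk k) hmeas]
  by_cases hx : x 0 = k
  · have hpre : (fun p : ℝ × (ℕ → E × ℝ) => consSeq (k, p.1) p.2) ⁻¹' cyl (m + 1) x B =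
        B 0 ×ˢ cyl m (fun i => x (i + 1)) (fun i => B (i + 1)) := by
      ext p
      simp [consSeq_mem_cyl, hx]
    rw [hpre, Measure.prod_prod, Measure.finsetSum_apply,
      Finset.sum_eq_single (x 1), (h.pastLaw_cyl k (m + 1) x hB).1 hx, Measure.smul_apply,
      (h.pastLaw_cyl (x 1) m _ hB').1 rfl, h.measure_past_mem_cyl hτ (m + 1) x hB,
      h.measure_past_mem_cyl hτ m _ hB', Finset.prod_range_succ', Finset.prod_range_succ', hx,
      div_eq_mul_inv, ENNReal.ofReal_mul (mul_nonneg (hP _ _) (hτ _).le),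
      ENNReal.ofReal_mul (hP _ _), smul_eq_mul]
    -- The two sides differ by this factor: `τ (x 1)` comes from the weight and its inverse from the
    -- mass of `L (x 1)`.
    · have hc : ENNReal.ofReal (τ (x 1)) * ENNReal.ofReal (τ (x 1))⁻¹ = 1 := by
        rw [← ENNReal.ofReal_mul (hτ _).le, mul_inv_cancel₀ (hτ _).ne', ENNReal.ofReal_one]
      simp only [zero_add]
      generalize (∑ k, ENNReal.ofReal (π k) * ENNReal.ofReal (τ k)⁻¹)⁻¹ = C
      generalize ENNReal.ofReal (τ k)⁻¹ = q
      generalize expMeasure (τ (x 1)) (B 1) = u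
      generalize ENNReal.ofReal (τ (x 1)) = t at hc ⊢
      generalize ENNReal.ofReal (τ (x 1))⁻¹ = s at hc ⊢
      generalize hp1 : ∏ i ∈ Finset.range m, ENNReal.ofReal (P (x (i + 1 + 1)) (x (i + 1))) = p1
      generalize hp2 : ∏ i ∈ Finset.range m, expMeasure (τ (x (i + 1 + 1))) (B (i + 1 + 1)) = p2
      generalize ENNReal.ofReal (P (x 1) k) = w
      generalize expMeasure (τ k) (B 0) = v
      generalize ENNReal.ofReal (π (x (m + 1))) = z
      calc _ = C * (z * (p1 * w)) * (p2 * u) * (q * v) * 1 := by rw [mul_one]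
        _ = _ := by rw [← hc]; ring
    · intro l _ hl
      rw [Measure.smul_apply, (h.pastLaw_cyl l m _ hB').2 (Ne.symm hl), smul_zero]
    · exact fun hn => (hn (Finset.mem_univ _)).elim
  · have hpre : (fun p : ℝ × (ℕ → E × ℝ) => consSeq (k, p.1) p.2) ⁻¹' cyl (m + 1) x B = ∅ := by
      ext p
      simp only [mem_preimage, consSeq_mem_cyl, mem_empty_iff_false, iff_false]
      exact fun hp => hx hp.1.1.symm
    rw [hpre, measure_empty, (h.pastLaw_cyl k (m + 1) x hB).2 hx]

end IsStationaryRenewal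

end Renewal

/-! ### The area along a piecewise constant path. -/

section Path

open Set Filter Topology

variable {E : Type*}

/-- The path `γ` has the value `y i` on `[s (i + 1), s i)`. -/
structure IsPiecewise (γ : ℝ → E) (s : ℕ → ℝ) (y : ℕ → E) : Prop where
  succ_le : ∀ i, s (i + 1) ≤ s i
  eq : ∀ i u, s (i + 1) ≤ u → u < s i → γ u = y i

namespace IsPiecewise

variable {γ : ℝ → E} {s : ℕ → ℝ} {y : ℕ → E}

lemma tail (h : IsPiecewise γ s y) :
    IsPiecewise γ (fun i => s (i + 1)) fun i => y (i + 1) :=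
  ⟨fun i => h.succ_le (i + 1), fun i => h.eq (i + 1)⟩

lemma antitone (h : IsPiecewise γ s y) : Antitone s := antitone_nat_of_succ_le h.succ_le

lemma intervalIntegrable (h : IsPiecewise γ s y) (f : E → ℝ) (N : ℕ) :
    IntervalIntegrable (fun u => f (γ u)) volume (s N) (s 0) := by
  induction N with
  | zero => exact IntervalIntegrable.refl
  | succ N ih =>
    refine IntervalIntegrable.trans ?_ ih
    rw [intervalIntegrable_iff_integrableOn_Ico_of_le (h.succ_le N)]
    refine IntegrableOn.congr_fun (f := fun _ => f (y N)) (by simp) (fun u hu => ?_)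
      measurableSet_Ico
    rw [h.eq N u hu.1 hu.2]

lemma integral_eq (h : IsPiecewise γ s y) (f : E → ℝ) {u : ℝ} (hu : s 1 ≤ u) (hu' : u ≤ s 0) :
    ∫ t in u..s 0, f (γ t) = f (y 0) * (s 0 - u) := by
  rw [intervalIntegral.integral_of_le hu', ← integral_Ico_eq_integral_Ioc,
    setIntegral_congr_fun (g := fun _ => f (y 0)) measurableSet_Ico
      fun t ht => by rw [h.eq 0 t (hu.trans ht.1) ht.2]]
  simp [hu', mul_comm]

/-- Split at `s 1`: arrivals before it are all discounted by the same factor `exp (-b (s 0 - s 1))`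
over the most recent sojourn, and those after it contribute `a * discounted`. This is `step`. -/
lemma lintegral_eq_accum (h : IsPiecewise γ s y) {a : E → ℝ} (ha : ∀ k, 0 ≤ a k) (b : E → ℝ)
    (N : ℕ) :
    ∫⁻ u in Ico (s N) (s 0), ENNReal.ofReal (a (γ u)) *
        ENNReal.ofReal (Real.exp (-∫ t in u..s 0, b (γ t))) =
      ENNReal.ofReal (accum a b N fun i => (y i, s i - s (i + 1))) := by
  induction N generalizing s y with
  | zero => simp [accum]
  | succ N ih =>
    have h1 : s (N + 1) ≤ s 1 := h.antitone (by omega)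
    have h0 : s 1 ≤ s 0 := h.succ_le 0
    have hnn : 0 ≤ accum a b N fun i => (y (i + 1), s (i + 1) - s (i + 1 + 1)) :=
      accum_nonneg ha b N fun i => sub_nonneg.2 (h.succ_le (i + 1))
    rw [← Ico_union_Ico_eq_Ico h1 h0,
      lintegral_union measurableSet_Ico (Ico_disjoint_Ico_same)]
    have hold : ∫⁻ u in Ico (s (N + 1)) (s 1), ENNReal.ofReal (a (γ u)) *
        ENNReal.ofReal (Real.exp (-∫ t in u..s 0, b (γ t))) =
        ENNReal.ofReal (Real.exp (-(b (y 0) * (s 0 - s 1)))) *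
          ENNReal.ofReal (accum a b N fun i => (y (i + 1), s (i + 1) - s (i + 1 + 1))) := by
      rw [← ih h.tail, ← lintegral_const_mul' _ _ ENNReal.ofReal_ne_top]
      refine setLIntegral_congr_fun measurableSet_Ico fun u hu => ?_
      have hi := h.tail.intervalIntegrable b N
      have hi1 : IntervalIntegrable (fun t => b (γ t)) volume u (s 1) :=
        hi.mono_set (by
          rw [uIcc_of_le hu.2.le, uIcc_of_le h1]
          exact Icc_subset_Icc_left hu.1)
      have hi0 : IntervalIntegrable (fun t => b (γ t)) volume (s 1) (s 0) :=
        h.intervalIntegrable b 1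
      rw [← intervalIntegral.integral_add_adjacent_intervals hi1 hi0, h.integral_eq b le_rfl h0,
        neg_add, Real.exp_add, ENNReal.ofReal_mul (Real.exp_pos _).le, mul_comm (ENNReal.ofReal _),
        mul_assoc, mul_left_comm, mul_comm (ENNReal.ofReal (a (γ u)))]
    have hnew : ∫⁻ u in Ico (s 1) (s 0), ENNReal.ofReal (a (γ u)) *
        ENNReal.ofReal (Real.exp (-∫ t in u..s 0, b (γ t))) =
        ENNReal.ofReal (a (y 0) * discounted (b (y 0)) (s 0 - s 1)) := by
      have hc : Continuous fun u : ℝ => Real.exp (-(b (y 0) * (s 0 - u))) := by fun_prop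
      have hd : discounted (b (y 0)) (s 0 - s 1) =
          ∫ u in Ico (s 1) (s 0), Real.exp (-(b (y 0) * (s 0 - u))) := by
        rw [integral_Ico_eq_integral_Ioc, ← intervalIntegral.integral_of_le h0,
          intervalIntegral.integral_comp_sub_left (fun v => Real.exp (-(b (y 0) * v)))]
        simp [discounted]
      rw [hd, ENNReal.ofReal_mul (ha _), ofReal_integral_eq_lintegral_ofReal
        ((hc.integrableOn_Icc).mono_set Ico_subset_Icc_self)
        (Eventually.of_forall fun _ => (Real.exp_pos _).le),
        ← lintegral_const_mul' _ _ ENNReal.ofReal_ne_top]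
      refine setLIntegral_congr_fun measurableSet_Ico fun u hu => ?_
      rw [h.eq 0 u hu.1 hu.2, h.integral_eq b hu.1 hu.2.le]
    rw [hold, hnew, accum, step, ENNReal.ofReal_add
      (mul_nonneg (ha _) (discounted_nonneg _ (sub_nonneg.2 h0)))
      (mul_nonneg (Real.exp_pos _).le hnn), ENNReal.ofReal_mul (Real.exp_pos _).le, add_comm]

lemma iUnion_Ico (hs : Tendsto s atTop atBot) (c : ℝ) : ⋃ N, Ico (s N) c = Iio c := by
  ext u
  simp only [mem_iUnion, mem_Ico, mem_Iio]
  refine ⟨fun ⟨_, h⟩ => h.2, fun hu => ?_⟩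
  obtain ⟨N, hN⟩ := (hs.eventually_le_atBot u).exists
  exact ⟨N, hN, hu⟩

lemma aemeasurable (h : IsPiecewise γ s y) (hs : Tendsto s atTop atBot) (f : E → ℝ) :
    AEMeasurable (fun u => f (γ u)) (volume.restrict (Iio (s 0))) := by
  rw [← iUnion_Ico hs, aemeasurable_iUnion_iff]
  intro N
  have := h.intervalIntegrable f N
  rw [intervalIntegrable_iff_integrableOn_Ico_of_le (h.antitone (Nat.zero_le N))] at this
  exact this.aestronglyMeasurable.aemeasurable

lemma continuousOn_integral (h : IsPiecewise γ s y) (hs : Tendsto s atTop atBot) (f : E → ℝ) :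
    ContinuousOn (fun u => ∫ t in u..s 0, f (γ t)) (Iio (s 0)) := by
  intro u hu
  obtain ⟨N, hN⟩ := (hs.eventually_lt_atBot u).exists
  have h1 := intervalIntegral.continuousOn_primitive_interval' (h.intervalIntegrable f N)
    right_mem_uIcc
  have h2 : uIcc (s N) (s 0) ∈ 𝓝 u := by
    rw [uIcc_of_le (hN.trans hu).le]
    exact Icc_mem_nhds hN hu
  have h3 := (h1.continuousAt h2).neg
  refine ContinuousAt.continuousWithinAt (h3.congr (Eventually.of_forall fun v => ?_))
  exact (intervalIntegral.integral_symm _ _).symm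

lemma area_eq_lintegral (h : IsPiecewise γ s y) (hs : Tendsto s atTop atBot) (h0 : s 0 = 0)
    (lam : E → ℝ) {β : E → ℝ} (hβ : ∀ k, 0 ≤ β k) {μ : ℝ} (hμ : 0 < μ) :
    area lam β μ γ = ∫⁻ u in Iio 0, ENNReal.ofReal (lam (γ u)) *
      ENNReal.ofReal (Real.exp (-∫ t in u..0, μ * β (γ t))) := by
  classical
  have := isProbabilityMeasure_expMeasure hμ
  have hcont : ContinuousOn (work β γ) (Iio 0) := by
    have := h.continuousOn_integral hs β
    rwa [h0] at this
  -- The path is controlled only before time 0, so `work` is replaced by a function that agrees with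
  -- it there and is measurable on the whole line.
  set g : ℝ → ℝ := (Iio 0).piecewise (work β γ) fun _ => 0 with hg
  have hgm : Measurable g := hcont.measurable_piecewise continuousOn_const measurableSet_Iio
  have hgw : ∀ u < 0, g u = work β γ u := fun u hu => piecewise_eq_of_mem _ _ _ hu
  have hpres : presentSet β γ = {p : ℝ × ℝ | p.1 < 0 ∧ 0 < p.2 ∧ g p.1 < p.2} := by
    ext p
    refine and_congr_right fun hp => ?_
    rw [hgw _ hp]
  have hmeas : MeasurableSet (presentSet β γ) := by
    rw [hpres]
    exact (measurableSet_lt measurable_fst measurable_const).inter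
      ((measurableSet_lt measurable_const measurable_snd).inter
        (measurableSet_lt (hgm.comp measurable_fst) measurable_snd))
  -- A customer arriving at `u < 0` is still present when its request exceeds the work done since,
  -- which has probability `exp (-μ F(u))`.
  have hsec : ∀ u, expMeasure μ (Prod.mk u ⁻¹' presentSet β γ) =
      (Iio 0).indicator (fun u => ENNReal.ofReal (Real.exp (-(μ * g u)))) u := by
    intro u
    by_cases hu : u < 0
    · have hw : 0 ≤ work β γ u :=
        intervalIntegral.integral_nonneg hu.le fun t _ => hβ (γ t)
      have hset : Prod.mk u ⁻¹' presentSet β γ = Ioi (work β γ u) := by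
        ext σ
        exact ⟨fun hσ => hσ.2.2, fun hσ => ⟨hu, hw.trans_lt hσ, hσ⟩⟩
      rw [hset, expMeasure_Ioi hμ hw, indicator_of_mem (mem_Iio.2 hu), hgw u hu]
    · have hset : Prod.mk u ⁻¹' presentSet β γ = ∅ := by
        ext σ
        exact ⟨fun hσ => hu hσ.1, fun hσ => hσ.elim⟩
      rw [hset, measure_empty, indicator_of_notMem (by simpa using hu)]
  have hd : AEMeasurable (fun u => ENNReal.ofReal (lam (γ u))) (volume.restrict (Iio 0)) := by
    have := (h.aemeasurable hs lam).ennreal_ofReal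
    rwa [h0] at this
  rw [area, intensity, Measure.prod_apply hmeas]
  simp_rw [hsec]
  rw [lintegral_indicator measurableSet_Iio, restrict_withDensity measurableSet_Iio,
    lintegral_withDensity_eq_lintegral_mul₀ hd (by fun_prop)]
  refine setLIntegral_congr_fun measurableSet_Iio fun u hu => ?_
  simp only [Pi.mul_apply]
  rw [hgw u hu, intervalIntegral.integral_const_mul, work]

lemma area_eq_total (h : IsPiecewise γ s y) (hs : Tendsto s atTop atBot) (h0 : s 0 = 0)
    {lam β : E → ℝ} (hlam : ∀ k, 0 ≤ lam k) (hβ : ∀ k, 0 ≤ β k) {μ : ℝ} (hμ : 0 < μ) :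
    area lam β μ γ = total lam (fun k => μ * β k) fun i => (y i, s i - s (i + 1)) := by
  rw [h.area_eq_lintegral hs h0 lam hβ hμ, ← iUnion_Ico hs 0, setLIntegral_iUnion_of_directed]
  · refine iSup_congr fun N => ?_
    have := h.lintegral_eq_accum hlam (fun k => μ * β k) N
    rwa [h0] at this
  · exact (monotone_nat_of_le_succ fun N => Ico_subset_Ico_left (h.succ_le N)).directed_le

end IsPiecewise

end Path

/-! ### Stationary distributions, and the area as a function of the random past. -/

section Stationary

open Set Filter Topology

lemma vecMul_generator {E : Type*} [Fintype E] [DecidableEq E] (P : Matrix E E ℝ) (τ v : E → ℝ) :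
    v ᵥ* generator P τ = (fun k => v k * τ k) ᵥ* P - fun k => v k * τ k := by
  have h : v ᵥ* diagonal τ = fun k => v k * τ k := funext fun k => vecMul_diagonal _ _ k
  rw [generator, ← vecMul_vecMul, h, vecMul_sub, vecMul_one]

/-- The stationary distribution of the environment is obtained from that of the routing matrix by
weighting with the mean sojourn times. -/
lemma eq_of_isStationaryForGenerator {E : Type*} [Fintype E] [DecidableEq E] {P : Matrix E E ℝ}
    (hirr : P.IsIrreducible) {τ : E → ℝ} (hτ : ∀ k, 0 < τ k) {π ϖ : E → ℝ}
    (hπ : IsStationaryDistribution P π) (hϖ : IsStationaryForGenerator (generator P τ) ϖ) (k : E) :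
    0 < ϖ k ∧ ϖ k = (∑ l, π l * (τ l)⁻¹)⁻¹ * (π k * (τ k)⁻¹) := by
  have hπpos := pos_of_mem_stdSimplex_of_vecMul_eq hirr hπ.1 hπ.2
  -- `ϖ G = 0` says that the flow `ϖ k * τ k` is invariant under `P`, hence proportional to `π`; the
  -- total mass of `ϖ` fixes the factor.
  have hinv : (fun k => ϖ k * τ k) ᵥ* P = fun k => ϖ k * τ k := by
    have := hϖ.2
    rwa [vecMul_generator, sub_eq_zero] at this
  obtain ⟨t, ht⟩ := exists_smul_eq_of_vecMul_eq hirr hπpos hinv hπ.2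
  have hk : ∀ k, ϖ k = t * (π k * (τ k)⁻¹) := fun k => by
    have h1 := congrFun ht k
    simp only [Pi.smul_apply, smul_eq_mul] at h1
    rw [← mul_assoc, ← h1, mul_inv_cancel_right₀ (hτ k).ne']
  have hpos : ∀ l, 0 < π l * (τ l)⁻¹ := fun l => mul_pos (hπpos l) (inv_pos.2 (hτ l))
  have hsum : 0 < ∑ l, π l * (τ l)⁻¹ := Finset.sum_pos (fun l _ => hpos l) ⟨k, Finset.mem_univ k⟩
  have hmul : t * ∑ l, π l * (τ l)⁻¹ = 1 := by
    rw [Finset.mul_sum, ← hϖ.1.2]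
    exact Finset.sum_congr rfl fun l _ => (hk l).symm
  have ht' : t = (∑ l, π l * (τ l)⁻¹)⁻¹ := eq_inv_of_mul_eq_one_left hmul
  rw [hk k, ht']
  exact ⟨mul_pos (inv_pos.2 hsum) (hpos k), rfl⟩

variable {Ω E : Type*} [MeasurableSpace Ω] [Fintype E] [MeasurableSpace E]
  {Pr : Measure Ω} {P : Matrix E E ℝ} {π τ : E → ℝ} {X : ℤ → Ω → E} {S : ℤ → Ω → ℝ}

namespace IsStationaryRenewal

lemma measure_state_zero_eq_ofReal [DecidableEq E]
    (h : IsStationaryRenewal Pr P π (fun k => expMeasure (τ k)) X S)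
    (hirr : P.IsIrreducible) (hτ : ∀ k, 0 < τ k) (hπ : IsStationaryDistribution P π) {ϖ : E → ℝ}
    (hϖ : IsStationaryForGenerator (generator P τ) ϖ) (k : E) :
    Pr {ω | X 0 ω = k} = ENNReal.ofReal (ϖ k) := by
  have hpos : ∀ l, 0 < π l * (τ l)⁻¹ := fun l =>
    mul_pos (pos_of_mem_stdSimplex_of_vecMul_eq hirr hπ.1 hπ.2 l) (inv_pos.2 (hτ l))
  have hsum : 0 < ∑ l, π l * (τ l)⁻¹ := Finset.sum_pos (fun l _ => hpos l) ⟨k, Finset.mem_univ k⟩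
  rw [h.measure_state_zero hτ, (eq_of_isStationaryForGenerator hirr hτ hπ hϖ k).2,
    ENNReal.ofReal_mul (inv_pos.2 hsum).le, ENNReal.ofReal_inv_of_pos hsum,
    ENNReal.ofReal_sum_of_nonneg fun l _ => (hpos l).le]
  simp_rw [ENNReal.ofReal_mul (hπ.1.1 _)]

variable [MeasurableSingletonClass E] {ν : E → Measure ℝ}

lemma ae_past (h : IsStationaryRenewal Pr P π ν X S) {p : (ℕ → E × ℝ) → Prop}
    (hp : ∀ k, ∀ᵐ y ∂pastLaw Pr X S k, p y) : ∀ᵐ ω ∂Pr, p (past X S ω) := by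
  have hk : ∀ᵐ ω ∂Pr, ∀ k, X 0 ω = k → p (past X S ω) := by
    rw [ae_all_iff]
    intro k
    have h1 := ae_of_ae_map h.measurable_past.aemeasurable (hp k)
    exact (ae_restrict_iff' (h.measurable_state 0 (measurableSet_singleton k))).1 h1
  filter_upwards [hk] with ω hω using hω _ rfl

lemma ae_area_eq_total [IsFiniteMeasure Pr]
    (h : IsStationaryRenewal Pr P π (fun k => expMeasure (τ k)) X S)
    (hP : ∀ k l, 0 ≤ P k l) (hsum : ∀ k, ∑ l, P k l = 1) (hτ : ∀ k, 0 < τ k) {Γ : ℝ → Ω → E}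
    (hΓ : ∀ᵐ ω ∂Pr, ∀ (n : ℤ) (u : ℝ), S n ω ≤ u → u < S (n + 1) ω → Γ u ω = X n ω)
    {lam β : E → ℝ} (hlam : ∀ k, 0 ≤ lam k) (hβ : ∀ k, 0 ≤ β k) {μ : ℝ} (hμ : 0 < μ) :
    ∀ᵐ ω ∂Pr, area lam β μ (fun u => Γ u ω) = total lam (fun k => μ * β k) (past X S ω) := by
  have hL := h.isBackwardLaw hP hτ
  filter_upwards [h.ae_past fun k => hL.ae_nonneg hτ k,
    h.ae_past fun k => hL.ae_tendsto_sum hP hsum hτ k, h.covers_zero, hΓ] with ω hnn hlim h0 hω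
  have hpw : IsPiecewise (fun u => Γ u ω) (pastEpoch S ω) fun i => X (-i) ω := by
    refine ⟨fun i => sub_nonneg.1 (hnn i), fun i u hu hu' => ?_⟩
    cases i with
    -- The sojourn covering 0 lasts until `S 1 > 0`; only its part before 0 belongs to the past.
    | zero => exact hω _ u hu (by simpa using lt_trans hu' h0.2)
    | succ i =>
      refine hω _ u hu ?_
      rw [show -((i + 1 : ℕ) : ℤ) + 1 = -i by push_cast; ring]
      exact hu'
  refine hpw.area_eq_total ?_ rfl hlam hβ hμ
  refine tendsto_neg_atTop_iff.1 (hlim.congr fun N => ?_)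
  -- The sojourn times telescope to minus the `N`-th past epoch, so their divergence sends the
  -- epochs to `-∞`.
  exact (Finset.sum_range_sub' (pastEpoch S ω) N).trans (zero_sub _)

end IsStationaryRenewal

end Stationary

end SemiMarkovQueue

/-! ### From the backward recursion to the conditional moments. -/

theorem mainTheorem5 {Ω E : Type*} [MeasurableSpace Ω]
    [Fintype E] [DecidableEq E] [MeasurableSpace E] [MeasurableSingletonClass E]
    (Pr : MeasureTheory.Measure Ω) [MeasureTheory.IsProbabilityMeasure Pr]
    -- routing matrix, rates of the exponential sojourn times
    (P : Matrix E E ℝ) (hP : P ∈ Matrix.rowStochastic ℝ E) (hirr : P.IsIrreducible)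
    (τ : E → ℝ) (hτ : ∀ k, 0 < τ k)
    -- the stationary environment
    (Γ : ℝ → Ω → E)
    (hΓ : SemiMarkovQueue.IsStationarySemiMarkov Pr P
      (fun k => ProbabilityTheory.expMeasure (τ k)) Γ)
    -- arrival rates, rate of the service requests, server speeds
    (lam : E → ℝ) (hlam : ∀ k, 0 ≤ lam k) (μ : ℝ) (hμ : 0 < μ)
    (β : E → ℝ) (hβ : ∀ k, 0 ≤ β k) (hβpos : ∃ k, 0 < β k)
    -- the stationary distribution of the environment
    (ϖ : E → ℝ)
    (hϖ : SemiMarkovQueue.IsStationaryForGenerator (SemiMarkovQueue.generator P τ) ϖ) :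
    (∀ k, 0 < ϖ k ∧ Pr {ω | Γ 0 ω = k} = ENNReal.ofReal (ϖ k)) ∧
    (∀ᵐ ω ∂Pr, SemiMarkovQueue.area lam β μ (fun u => Γ u ω) < ⊤) ∧
    (∀ (n : ℕ) (k : E), MeasureTheory.Integrable
      (fun ω => (SemiMarkovQueue.area lam β μ fun u => Γ u ω).toReal ^ n)
      (ProbabilityTheory.cond Pr {ω | Γ 0 ω = k})) ∧
    ∀ n : ℕ, 0 < n →
      Matrix.vecMul
        (Matrix.vecMul (SemiMarkovQueue.momentVec Pr lam β μ Γ n) (Matrix.diagonal ϖ))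
        ((n : ℝ) • Matrix.diagonal (fun k => μ * β k) - SemiMarkovQueue.generator P τ) =
      (n : ℝ) • Matrix.vecMul
        (Matrix.vecMul (SemiMarkovQueue.momentVec Pr lam β μ Γ (n - 1)) (Matrix.diagonal ϖ))
        (Matrix.diagonal lam) := by
  obtain ⟨-, π, X, S, hπ, hren, hpath⟩ := hΓ
  have hP0 := hirr.nonneg
  have hsum := Matrix.sum_row_of_mem_rowStochastic hP
  have hL := hren.isBackwardLaw hP0 hτ
  set L := SemiMarkovQueue.pastLaw Pr X S with hLdef
  set b : E → ℝ := fun k => μ * β k with hb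
  have hb0 : ∀ k, 0 ≤ b k := fun k => mul_nonneg hμ.le (hβ k)
  have hbpos : ∃ k, 0 < b k := hβpos.imp fun k hk => mul_pos hμ hk
  have hstate : ∀ᵐ ω ∂Pr, Γ 0 ω = X 0 ω := by
    filter_upwards [hren.covers_zero, hpath] with ω h0 hω using hω 0 0 h0.1 h0.2
  have hset : ∀ k, ({ω | Γ 0 ω = k} : Set Ω) =ᵐ[Pr] ({ω | X 0 ω = k} : Set Ω) := fun k => by
    rw [Filter.eventuallyEq_set]
    filter_upwards [hstate] with ω hω
    simp [hω]
  have hϖpos : ∀ k, 0 < ϖ k := fun k =>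
    (SemiMarkovQueue.eq_of_isStationaryForGenerator hirr hτ hπ hϖ k).1
  have hprob : ∀ k, Pr {ω | Γ 0 ω = k} = ENNReal.ofReal (ϖ k) := fun k => by
    rw [measure_congr (hset k)]
    exact hren.measure_state_zero_eq_ofReal hirr hτ hπ hϖ k
  have harea := hren.ae_area_eq_total hP0 hsum hτ hpath hlam hβ hμ
  have htop := hL.total_moment_lt_top (a := lam) hirr hsum hτ hlam hb0 hbpos
  have hfin : ∀ᵐ ω ∂Pr, SemiMarkovQueue.total lam b (SemiMarkovQueue.past X S ω) < ⊤ := by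
    refine hren.ae_past fun k => ae_lt_top (SemiMarkovQueue.measurable_total lam b) ?_
    simpa using (htop 1 k).ne
  have hcond : ∀ k, ProbabilityTheory.cond Pr {ω | Γ 0 ω = k} =
      (ENNReal.ofReal (ϖ k))⁻¹ • Pr.restrict {ω | X 0 ω = k} := fun k => by
    rw [ProbabilityTheory.cond, hprob k, Measure.restrict_congr_set (hset k)]
  have hmeas : ∀ n : ℕ, Measurable fun ω =>
      SemiMarkovQueue.total lam b (SemiMarkovQueue.past X S ω) ^ n := fun n =>
    ((SemiMarkovQueue.measurable_total lam b).comp hren.measurable_past).pow_const n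
  have hlint : ∀ n k, ∫⁻ ω in {ω | X 0 ω = k},
      SemiMarkovQueue.total lam b (SemiMarkovQueue.past X S ω) ^ n ∂Pr =
      ∫⁻ y, SemiMarkovQueue.total lam b y ^ n ∂L k := fun n k =>
    (lintegral_map ((SemiMarkovQueue.measurable_total lam b).pow_const n)
      hren.measurable_past).symm
  have hae : ∀ n k, (fun ω => (SemiMarkovQueue.area lam β μ fun u => Γ u ω).toReal ^ n)
      =ᵐ[Pr.restrict {ω | X 0 ω = k}]
      fun ω => (SemiMarkovQueue.total lam b (SemiMarkovQueue.past X S ω) ^ n).toReal :=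
    fun n k => by
      filter_upwards [ae_restrict_of_ae harea] with ω hω
      rw [hω, ENNReal.toReal_pow]
  -- Multiplication by `ϖ k` undoes the conditioning, so the entries of `m⁽ⁿ⁾ Π` are integrals
  -- against the unnormalised `L k`.
  have hmom : ∀ n k, SemiMarkovQueue.momentVec Pr lam β μ Γ n k * ϖ k =
      (∫⁻ y, SemiMarkovQueue.total lam b y ^ n ∂L k).toReal := fun n k => by
    rw [SemiMarkovQueue.momentVec, hcond k, integral_smul_measure, integral_congr_ae (hae n k),
      integral_toReal (hmeas n).aemeasurable, hlint, ENNReal.toReal_inv,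
      ENNReal.toReal_ofReal (hϖpos k).le, smul_eq_mul, mul_comm, mul_inv_cancel_left₀ (hϖpos k).ne']
    filter_upwards [ae_restrict_of_ae hfin] with ω hω using ENNReal.pow_lt_top hω
  refine ⟨fun k => ⟨hϖpos k, hprob k⟩, ?_, fun n k => ?_, fun n hn => ?_⟩
  · filter_upwards [harea, hfin] with ω h1 h2
    rw [h1]
    exact h2
  · rw [hcond k]
    refine Integrable.smul_measure ?_
      (ENNReal.inv_ne_top.2 (ENNReal.ofReal_pos.2 (hϖpos k)).ne')
    refine (integrable_toReal_of_lintegral_ne_top (hmeas n).aemeasurable ?_).congr (hae n k).symm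
    rw [hlint]
    exact (htop n k).ne
  · have hvec : ∀ m, SemiMarkovQueue.momentVec Pr lam β μ Γ m ᵥ* Matrix.diagonal ϖ =
        fun k => (∫⁻ y, SemiMarkovQueue.total lam b y ^ m ∂L k).toReal := fun m => by
      funext k
      rw [Matrix.vecMul_diagonal, hmom]
    funext k
    have hrec := congrArg ENNReal.toReal (hL.total_moment_recursion hP0 hτ hlam hb0 hn k)
    rw [ENNReal.toReal_add, ENNReal.toReal_sum, ENNReal.toReal_mul, ENNReal.toReal_mul,
      ENNReal.toReal_ofReal (add_nonneg (hτ k).le (mul_nonneg n.cast_nonneg (hb0 k))),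
      ENNReal.toReal_ofReal (mul_nonneg n.cast_nonneg (hlam k))] at hrec
    · simp_rw [ENNReal.toReal_mul, ENNReal.toReal_ofReal (mul_nonneg (hP0 _ k) (hτ _).le)] at hrec
      rw [hvec, hvec, Matrix.vecMul_sub, Matrix.vecMul_smul, SemiMarkovQueue.vecMul_generator]
      simp only [Pi.sub_apply, Pi.smul_apply, smul_eq_mul, Matrix.vecMul_diagonal]
      have hdot : ((fun l => (∫⁻ y, SemiMarkovQueue.total lam b y ^ n ∂L l).toReal * τ l) ᵥ* P) k =
          ∑ l, P l k * τ l * (∫⁻ y, SemiMarkovQueue.total lam b y ^ n ∂L l).toReal :=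
        Finset.sum_congr rfl fun l _ => by ring
      rw [hdot]
      -- The term `τ k * M n k` of the recursion is the diagonal part of `-G`, and the routing sum
      -- is the remaining part of `G`.
      linear_combination hrec
    · exact fun l _ => (ENNReal.mul_lt_top ENNReal.ofReal_lt_top (htop n l)).ne
    · exact (ENNReal.sum_lt_top.2 fun l _ =>
        ENNReal.mul_lt_top ENNReal.ofReal_lt_top (htop n l)).ne
    · exact (ENNReal.mul_lt_top ENNReal.ofReal_lt_top (htop (n - 1) k)).ne
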